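/- Let $\sigma\in\mathbb R$, $\beta>0$, and $\Omega=\mathbb C\setminus\mathbb R$. Let $(X_t)_{t\ge 0}$ be a family of Borel probability measures on $\mathbb R$ whose Stieltjes transform $M(t,z)=\int\frac{dX_t(x)}{x-z}$, $(t,z)\in[0,\infty)\times\Omega$, solves $$M_t=(2\sigma^2M+z)M_z+M\quad (t>0),\qquad M(0,z)=\int\frac{dX_0(x)}{x-z},$$ the initial value being attained continuously as $t\downarrow 0$ for each $z\in\Omega$. For $t\ge 0$ put $$h_t(z)=ze^t+\sigma^2(e^t-e^{-t})M(t,z),\qquad g_t(w)=e^{-t}w-\sigma^2(e^t-e^{-t})\int\frac{dX_0(x)}{x-w},$$ and $h_t^{t_0}=g_{t_0}\circ h_t$ for $t\ge t_0\ge 0$. For an injective holomorphic function $v$ let $$(Sv)(z_1,z_2)=\frac{v'(z_1)v'(z_2)}{(v(z_1)-v(z_2))^2}-\frac1{(z_1-z_2)^2}\ \ (z_1\ne z_2),\qquad (Sv)(z,z)=\frac16\left(\frac{v'''(z)}{v'(z)}-\frac32\Big(\frac{v''(z)}{v'(z)}\Big)^2\right).$$ Let $k\ge 0$, $t_0\ge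 0$, and let $\phi_{t_0}(s,z)$ be an analytic function of $(s,z)\in\mathbb C^k\times\Omega^k$. Consider the initial value problem $$\frac{\partial\phi}{\partial t}=\sum_{j=1}^k\left[s_j\Big(1+2\sigma^2\frac{\partial M(t,z_j)}{\partial z_j}\Big)\frac{\partial\phi}{\partial s_j}+\big(z_j+2\sigma^2M(t,z_j)\big)\frac{\partial\phi}{\partial z_j}\right]$$ $$\qquad+\left\{2i\sigma^2\Big(\frac2\beta-1\Big)\sum_{j=1}^k\int\frac{s_j\,dX_t(x)}{(x-z_j)^3}-\frac{2\sigma^2}{\beta}\sum_{j=1}^k\sum_{l=1}^k\int\frac{s_js_l\,dX_t(x)}{(x-z_j)^2(x-z_l)^2}\right\}\phi$$ in $U=\{(t,s,z): t>t_0,\ s\in\mathbb C^k,\ z\in\Omega^k\}$, with $\phi(t_0,s,z)=\phi_{t_0}(s,z)$ on $\Gamma=\{t_0\}\times\mathbb C^k\times\Omega^k$. A solution is a complex-valued function $\phi$, continuous on $U\cup\Gamma$, whose partial derivatives in $t$ (real) and in each $s_j$, $z_j$ (complex) exist in $U$ and satisfy the equation there, and which takes the prescribed values on $\Gamma$. Then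 for every $t\ge t_0$ the function $h_t^{t_0}$ is a holomorphic injective map of $\Omega$ into $\Omega$ with nowhere vanishing derivative, and the initial value problem has exactly one solution, namely $$\phi(t,s,z)=\phi_{t_0}\Big(\big(s_j\,{h_t^{t_0}}'(z_j)\big)_{j=1}^k,\ \big(h_t^{t_0}(z_j)\big)_{j=1}^k\Big)\exp\Big\{i\sum_{j=1}^ks_j\mu_j-\frac12\sum_{j=1}^k\sum_{l=1}^ks_js_l\Lambda_{jl}\Big\},$$ where $$\mu_j=\frac12\Big(\frac2\beta-1\Big)\frac{{h_t^{t_0}}''(z_j)}{{h_t^{t_0}}'(z_j)},\qquad \Lambda_{jl}=\Lambda_{lj}=\frac2\beta\,(Sh_t^{t_0})(z_j,z_l).$$ -/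

import Mathlib

open MeasureTheory Set

namespace DysonFluct

noncomputable section

/-- The set `Ω = ℂ \ ℝ`. -/
def Omega : Set ℂ := {z | z.im ≠ 0}

/-- The product set `Ω^k`. -/
def OmegaPow (k : ℕ) : Set (Fin k → ℂ) := {z | ∀ j, z j ∈ Omega}

/-- The Stieltjes transform `∫ dν(x) / (x - z)` of a measure `ν` on the real line. -/
def stieltjes (ν : Measure ℝ) (z : ℂ) : ℂ := ∫ x : ℝ, 1 / ((x : ℂ) - z) ∂ν

/-- `(X_t)_{t ≥ 0}` is the limiting measure process with parameter `σ` started at `X 0`: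
a family of Borel probability measures on `ℝ` whose Stieltjes transform
`M(t, z) = ∫ dX_t(x) / (x - z)` solves, on `[0, ∞) × Ω`, the initial value problem
`M_t = (2 σ² M + z) M_z + M` for `t > 0`, the initial value `M(0, z)` (the Stieltjes
transform of `X 0`) being attained continuously as `t ↓ 0`. This property determines the
family in terms of `X 0`. -/
structure IsLimitProcess (σ : ℝ) (X : ℝ → Measure ℝ) : Prop where
  isProbabilityMeasure : ∀ t : ℝ, 0 ≤ t → IsProbabilityMeasure (X t)
  hasDerivAt : ∀ t : ℝ, 0 < t → ∀ z ∈ Omega,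
    HasDerivAt (fun τ : ℝ => stieltjes (X τ) z)
      ((2 * (σ : ℂ) ^ 2 * stieltjes (X t) z + z) * deriv (stieltjes (X t)) z
        + stieltjes (X t) z) t
  initial : ∀ z ∈ Omega,
    ContinuousWithinAt (fun τ : ℝ => stieltjes (X τ) z) (Ici 0) 0

/-- `h_t(z) = z e^t + σ² (e^t - e^{-t}) M(t, z)`. -/
def hMap (σ : ℝ) (X : ℝ → Measure ℝ) (t : ℝ) (z : ℂ) : ℂ :=
  z * (Real.exp t : ℂ)
    + (σ : ℂ) ^ 2 * ((Real.exp t : ℂ) - (Real.exp (-t) : ℂ)) * stieltjes (X t) z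

/-- `g_t(w) = e^{-t} w - σ² (e^t - e^{-t}) f(w)`, where `f` is the Stieltjes transform
of `X 0`. -/
def gMap (σ : ℝ) (X : ℝ → Measure ℝ) (t : ℝ) (w : ℂ) : ℂ :=
  (Real.exp (-t) : ℂ) * w
    - (σ : ℂ) ^ 2 * ((Real.exp t : ℂ) - (Real.exp (-t) : ℂ)) * stieltjes (X 0) w

/-- `h_t^{t₀} = g_{t₀} ∘ h_t`. -/
def hTrans (σ : ℝ) (X : ℝ → Measure ℝ) (t t₀ : ℝ) (z : ℂ) : ℂ :=
  gMap σ X t₀ (hMap σ X t z)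

/-- The Schwarzian derivative `v'''/v' - (3/2) (v''/v')²`. -/
def schwarzian (v : ℂ → ℂ) (z : ℂ) : ℂ :=
  iteratedDeriv 3 v z / deriv v z - 3 / 2 * (iteratedDeriv 2 v z / deriv v z) ^ 2

open Classical in
/-- The generalized Schwarzian derivative
`v'(z₁) v'(z₂) / (v(z₁) - v(z₂))² - 1 / (z₁ - z₂)²`, equal to one sixth of the Schwarzian
derivative on the diagonal. -/
def genSchwarzian (v : ℂ → ℂ) (z₁ z₂ : ℂ) : ℂ :=
  if z₁ = z₂ then 1 / 6 * schwarzian v z₁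
  else deriv v z₁ * deriv v z₂ / (v z₁ - v z₂) ^ 2 - 1 / (z₁ - z₂) ^ 2

/-- `φ(t, s, z)` is a solution of the initial value problem in
`U = {t > t₀, s ∈ ℂ^k, z ∈ Ω^k}` with initial data `φ₀(s, z)` on `Γ = {t = t₀}`:
it is continuous on `U ∪ Γ`, its partial derivatives with respect to `t` (real) and to every
`s_j`, `z_j` (complex) exist in `U` and satisfy the equation there, and it agrees with `φ₀`
on `Γ`. -/
structure IsSolution (σ β : ℝ) (X : ℝ → Measure ℝ) {k : ℕ} (t₀ : ℝ)
    (φ₀ : (Fin k → ℂ) → (Fin k → ℂ) → ℂ)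
    (φ : ℝ → (Fin k → ℂ) → (Fin k → ℂ) → ℂ) : Prop where
  continuousOn : ContinuousOn
    (fun p : ℝ × (Fin k → ℂ) × (Fin k → ℂ) => φ p.1 p.2.1 p.2.2)
    (Ici t₀ ×ˢ (univ ×ˢ OmegaPow k))
  differentiableAt_s : ∀ t : ℝ, t₀ < t → ∀ s : Fin k → ℂ, ∀ z ∈ OmegaPow k, ∀ j : Fin k,
    DifferentiableAt ℂ (fun ζ : ℂ => φ t (Function.update s j ζ) z) (s j)
  differentiableAt_z : ∀ t : ℝ, t₀ < t → ∀ s : Fin k → ℂ, ∀ z ∈ OmegaPow k, ∀ j : Fin k,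
    DifferentiableAt ℂ (fun ζ : ℂ => φ t s (Function.update z j ζ)) (z j)
  pde : ∀ t : ℝ, t₀ < t → ∀ s : Fin k → ℂ, ∀ z ∈ OmegaPow k,
    HasDerivAt (fun τ : ℝ => φ τ s z)
      ((∑ j : Fin k,
          (s j * (1 + 2 * (σ : ℂ) ^ 2 * deriv (stieltjes (X t)) (z j))
              * deriv (fun ζ : ℂ => φ t (Function.update s j ζ) z) (s j)
            + (z j + 2 * (σ : ℂ) ^ 2 * stieltjes (X t) (z j))
              * deriv (fun ζ : ℂ => φ t s (Function.update z j ζ)) (z j)))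
        + (2 * Complex.I * (σ : ℂ) ^ 2 * (2 / (β : ℂ) - 1)
              * (∑ j : Fin k, ∫ x : ℝ, s j / ((x : ℂ) - z j) ^ 3 ∂(X t))
            - 2 * (σ : ℂ) ^ 2 / (β : ℂ)
              * (∑ j : Fin k, ∑ l : Fin k,
                  ∫ x : ℝ, s j * s l / (((x : ℂ) - z j) ^ 2 * ((x : ℂ) - z l) ^ 2) ∂(X t)))
          * φ t s z) t
  initial : ∀ s : Fin k → ℂ, ∀ z ∈ OmegaPow k, φ t₀ s z = φ₀ s z

/-- `μ_j = (1/2) (2/β - 1) h''(z_j) / h'(z_j)` with `h = h_t^{t₀}`, as a function of `z_j`. -/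
def meanCoeff (σ β : ℝ) (X : ℝ → Measure ℝ) (t t₀ : ℝ) (z : ℂ) : ℂ :=
  1 / 2 * (2 / (β : ℂ) - 1)
    * (iteratedDeriv 2 (hTrans σ X t t₀) z / deriv (hTrans σ X t t₀) z)

/-- `Λ_{jl} = (2/β) (S h_t^{t₀})(z_j, z_l)`, as a function of `z_j` and `z_l`. -/
def covCoeff (σ β : ℝ) (X : ℝ → Measure ℝ) (t t₀ : ℝ) (z₁ z₂ : ℂ) : ℂ :=
  2 / (β : ℂ) * genSchwarzian (hTrans σ X t t₀) z₁ z₂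

/-- The function `φ₀(s · h'(z), h(z)) exp(i ∑ s_j μ_j - (1/2) ∑∑ s_j s_l Λ_{jl})`, with
`h = h_t^{t₀}` applied to each coordinate. -/
def explicitSolution (σ β : ℝ) (X : ℝ → Measure ℝ) {k : ℕ} (t₀ : ℝ)
    (φ₀ : (Fin k → ℂ) → (Fin k → ℂ) → ℂ) (t : ℝ) (s z : Fin k → ℂ) : ℂ :=
  φ₀ (fun j => s j * deriv (hTrans σ X t t₀) (z j)) (fun j => hTrans σ X t t₀ (z j))
    * Complex.exp (Complex.I * (∑ j : Fin k, s j * meanCoeff σ β X t t₀ (z j))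
        - 1 / 2 * (∑ j : Fin k, ∑ l : Fin k,
            s j * s l * covCoeff σ β X t t₀ (z j) (z l)))

end

end DysonFluct

/-!
Uniqueness and the solution formula both come from the characteristics of the equation
`M_t = (2σ²M + z) M_z + M` for the Stieltjes transform `M(t, z)` of `X_t`.

Flow. The characteristic through `z` at time `t` has the explicit candidate
`τ ↦ charPath σ X t τ z = e^{t-τ} z + σ² (e^{t-τ} - e^{τ-t}) M(t, z)`. Since `Im M` has the sign of
`Im z`, it moves away from the real axis as `τ` decreases. The difference
`M(τ, charPath) - e^{τ-t} M(t, z)` solves a linear equation along it and vanishes at `τ = t`, so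
it vanishes for all `0 ≤ τ ≤ t` (`stieltjes_charPath`); no existence theorem for differential
equations is needed. Hence `h_t^{t₀} = charPath σ X t t₀` on `Ω` (`hTrans_eq`), these maps form a
flow (`charPath_charPath`), and `h_t^{t₀}` has the holomorphic left inverse
`y ↦ a y - b ∫ (x - y)⁻¹ dX_{t₀}(x)` with `a = e^{t₀-t}`, `b = σ² (e^{t-t₀} - e^{t₀-t})`, which
makes it injective with nonvanishing derivative.

Coefficients. Through this inverse, `h' = deriv h_t^{t₀}`, `h''/h'` and the generalized Schwarzian
derivative become rational expressions in `a`, `b` and moments of the fixed measure `X_{t₀}` at the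
transported points `y = h(z)`: with the divided difference
`q(y, u) = a - b ∫ (x - y)⁻¹ (x - u)⁻¹ dX_{t₀}(x)` one has `h'(z) = 1 / q(y, y)`, and
`S h(z, w) = h'(z) h'(w) (b R / q + b² T T' / q²)`, where `T`, `T'`, `R` are the moments of orders
`(2, 1)`, `(1, 2)`, `(2, 2)` (`genSchwarzian_hTrans`). The formula is regular on the diagonal, so
the solution formula is holomorphic in `s` and `z`, continuous, and differentiable in time.
For fixed `y` and `r = s h'(z)`, its exponent is a function of time whose derivative is exactly the
zeroth order coefficient of the equation (`hasDerivAt_exponent`), because `b' q - b q' = 2σ²` and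
because the moments of `X_t` transform accordingly (`moment_three`, `moment_two_two`).

Equation. A solution is only assumed continuous with separate partial derivatives. Continuity and
Cauchy's estimate make the complex partial derivatives locally uniform, so the chain rule holds
along curves (`hasDerivAt_along_curve`). Along a characteristic `y` and `r` are constant and the
equation reads `φ' = sourceCoeff φ`. Thus `φ exp(-exponent)` is constant for every solution `φ`,
which gives uniqueness. Conversely the explicit function satisfies this equation along
characteristics, and the chain rule turns it back into the partial differential equation.
-/

namespace DysonFluct

noncomputable section

open Filter Topology

/-! ### Moments of the Cauchy kernel -/

/-- The mixed moment `∫ (x - z)⁻ᵃ (x - w)⁻ᵇ dν(x)` of the Cauchy kernel. On the diagonal it is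
the moment of order `a + b`, so that these functions extend the divided differences of the
Stieltjes transform to coinciding arguments. -/
def cauchyMoment (ν : Measure ℝ) (a b : ℕ) (z w : ℂ) : ℂ :=
  ∫ x : ℝ, ((x : ℂ) - z)⁻¹ ^ a * ((x : ℂ) - w)⁻¹ ^ b ∂ν

lemma isOpen_Omega : IsOpen Omega :=
  isOpen_ne_fun Complex.continuous_im continuous_const

lemma isOpen_OmegaPow (k : ℕ) : IsOpen (OmegaPow k) := by
  simp only [OmegaPow, ofPred_forall]
  exact isOpen_iInter_of_finite fun j => isOpen_Omega.preimage (continuous_apply j)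

lemma ofReal_sub_ne_zero {z : ℂ} (hz : z ∈ Omega) (x : ℝ) : (x : ℂ) - z ≠ 0 := by
  intro h
  apply hz
  have := congrArg Complex.im h
  simpa using this

lemma norm_inv_sub_le {z : ℂ} (hz : z ∈ Omega) (x : ℝ) : ‖((x : ℂ) - z)⁻¹‖ ≤ |z.im|⁻¹ := by
  rw [norm_inv]
  have h : |z.im| ≤ ‖(x : ℂ) - z‖ := by
    have := Complex.abs_im_le_norm ((x : ℂ) - z)
    simpa using this
  exact inv_anti₀ (abs_pos.2 hz) h

lemma continuous_kernel {z w : ℂ} (hz : z ∈ Omega) (hw : w ∈ Omega) (a b : ℕ) :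
    Continuous fun x : ℝ => ((x : ℂ) - z)⁻¹ ^ a * ((x : ℂ) - w)⁻¹ ^ b := by
  refine (Continuous.pow (Continuous.inv₀ (by fun_prop) (ofReal_sub_ne_zero hz)) _).mul
    (Continuous.pow (Continuous.inv₀ (by fun_prop) (ofReal_sub_ne_zero hw)) _)

lemma norm_kernel_le {z w : ℂ} (hz : z ∈ Omega) (hw : w ∈ Omega) (a b : ℕ) (x : ℝ) :
    ‖((x : ℂ) - z)⁻¹ ^ a * ((x : ℂ) - w)⁻¹ ^ b‖ ≤ |z.im|⁻¹ ^ a * |w.im|⁻¹ ^ b := by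
  rw [norm_mul, norm_pow, norm_pow]
  gcongr
  · exact norm_inv_sub_le hz x
  · exact norm_inv_sub_le hw x

lemma integrable_kernel (ν : Measure ℝ) [IsFiniteMeasure ν] {z w : ℂ} (hz : z ∈ Omega)
    (hw : w ∈ Omega) (a b : ℕ) :
    Integrable (fun x : ℝ => ((x : ℂ) - z)⁻¹ ^ a * ((x : ℂ) - w)⁻¹ ^ b) ν :=
  (integrable_const (|z.im|⁻¹ ^ a * |w.im|⁻¹ ^ b)).mono'
    (continuous_kernel hz hw a b).aestronglyMeasurable
    (Eventually.of_forall (norm_kernel_le hz hw a b))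

lemma norm_cauchyMoment_le (ν : Measure ℝ) [IsProbabilityMeasure ν] {z w : ℂ} (hz : z ∈ Omega)
    (hw : w ∈ Omega) (a b : ℕ) :
    ‖cauchyMoment ν a b z w‖ ≤ |z.im|⁻¹ ^ a * |w.im|⁻¹ ^ b := by
  have := norm_integral_le_of_norm_le_const (μ := ν)
    (Eventually.of_forall (norm_kernel_le hz hw a b))
  simpa [cauchyMoment] using this

lemma cauchyMoment_diag (ν : Measure ℝ) (a b : ℕ) (z w : ℂ) :
    cauchyMoment ν a b z z = cauchyMoment ν (a + b) 0 z w := by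
  simp [cauchyMoment, pow_add]

lemma cauchyMoment_zero_right (ν : Measure ℝ) (a : ℕ) (z w : ℂ) :
    cauchyMoment ν a 0 z w = cauchyMoment ν a 0 z z := by
  simp [cauchyMoment]

lemma cauchyMoment_zero_left (ν : Measure ℝ) (b : ℕ) (z w : ℂ) :
    cauchyMoment ν 0 b z w = cauchyMoment ν b 0 w w := by
  simp [cauchyMoment]

lemma stieltjes_eq (ν : Measure ℝ) (z w : ℂ) : stieltjes ν z = cauchyMoment ν 1 0 z w := by
  simp [cauchyMoment, stieltjes]

lemma hasDerivAt_inv_sub_pow {z : ℂ} (hz : z ∈ Omega) (x : ℝ) (a : ℕ) :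
    HasDerivAt (fun ζ : ℂ => ((x : ℂ) - ζ)⁻¹ ^ a) (a * ((x : ℂ) - z)⁻¹ ^ (a + 1)) z := by
  have h0 := ofReal_sub_ne_zero hz x
  have h1 : HasDerivAt (fun ζ : ℂ => ((x : ℂ) - ζ)⁻¹) (((x : ℂ) - z)⁻¹ ^ 2) z := by
    refine (((hasDerivAt_id z).const_sub (x : ℂ)).fun_inv h0).congr_deriv ?_
    simp
  refine (h1.fun_pow a).congr_deriv ?_
  rcases a with _ | a
  · simp
  · simp only [Nat.add_sub_cancel]
    ring

/-- The derivative of the two-variable Cauchy kernel. -/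
def kernelFDeriv (a b : ℕ) (p : ℂ × ℂ) (x : ℝ) : ℂ × ℂ →L[ℂ] ℂ :=
  ((a : ℂ) * (((x : ℂ) - p.1)⁻¹ ^ (a + 1) * ((x : ℂ) - p.2)⁻¹ ^ b)) •
      ContinuousLinearMap.fst ℂ ℂ ℂ
    + ((b : ℂ) * (((x : ℂ) - p.1)⁻¹ ^ a * ((x : ℂ) - p.2)⁻¹ ^ (b + 1))) •
      ContinuousLinearMap.snd ℂ ℂ ℂ

lemma hasFDerivAt_kernel {p : ℂ × ℂ} (h1 : p.1 ∈ Omega) (h2 : p.2 ∈ Omega) (a b : ℕ) (x : ℝ) :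
    HasFDerivAt (fun p : ℂ × ℂ => ((x : ℂ) - p.1)⁻¹ ^ a * ((x : ℂ) - p.2)⁻¹ ^ b)
      (kernelFDeriv a b p x) p := by
  have d1 := (hasDerivAt_inv_sub_pow h1 x a).comp_hasFDerivAt p
    (hasFDerivAt_fst (𝕜 := ℂ) (E := ℂ) (F := ℂ) (p := p))
  have d2 := (hasDerivAt_inv_sub_pow h2 x b).comp_hasFDerivAt p
    (hasFDerivAt_snd (𝕜 := ℂ) (E := ℂ) (F := ℂ) (p := p))
  refine (d1.mul d2).congr_fderiv ?_
  ext <;> simp [kernelFDeriv] <;> ring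

lemma norm_kernelFDeriv_le {p : ℂ × ℂ} (h1 : p.1 ∈ Omega) (h2 : p.2 ∈ Omega) (a b : ℕ) (x : ℝ) :
    ‖kernelFDeriv a b p x‖ ≤ a * (|p.1.im|⁻¹ ^ (a + 1) * |p.2.im|⁻¹ ^ b)
      + b * (|p.1.im|⁻¹ ^ a * |p.2.im|⁻¹ ^ (b + 1)) := by
  have n1 := ContinuousLinearMap.norm_fst_le ℂ ℂ ℂ
  have n2 := ContinuousLinearMap.norm_snd_le ℂ ℂ ℂ
  refine (norm_add_le _ _).trans (add_le_add ?_ ?_)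
  · rw [norm_smul, norm_mul, Complex.norm_natCast]
    refine (mul_le_of_le_one_right (by positivity) n1).trans ?_
    gcongr
    exact norm_kernel_le h1 h2 _ _ _
  · rw [norm_smul, norm_mul, Complex.norm_natCast]
    refine (mul_le_of_le_one_right (by positivity) n2).trans ?_
    gcongr
    exact norm_kernel_le h1 h2 _ _ _

lemma continuous_kernelFDeriv {p : ℂ × ℂ} (h1 : p.1 ∈ Omega) (h2 : p.2 ∈ Omega) (a b : ℕ) :
    Continuous (kernelFDeriv a b p) :=
  ((continuous_const.mul (continuous_kernel h1 h2 (a + 1) b)).smul continuous_const).add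
    ((continuous_const.mul (continuous_kernel h1 h2 a (b + 1))).smul continuous_const)

lemma integral_kernelFDeriv (ν : Measure ℝ) [IsFiniteMeasure ν] {z w : ℂ} (hz : z ∈ Omega)
    (hw : w ∈ Omega) (a b : ℕ) :
    ∫ x, kernelFDeriv a b (z, w) x ∂ν
      = (a * cauchyMoment ν (a + 1) b z w) • ContinuousLinearMap.fst ℂ ℂ ℂ
        + (b * cauchyMoment ν a (b + 1) z w) • ContinuousLinearMap.snd ℂ ℂ ℂ := by
  unfold kernelFDeriv cauchyMoment
  rw [integral_add, integral_smul_const, integral_smul_const, integral_const_mul,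
    integral_const_mul]
  · exact ((integrable_kernel ν hz hw (a + 1) b).const_mul _).smul_const _
  · exact ((integrable_kernel ν hz hw a (b + 1)).const_mul _).smul_const _

lemma hasFDerivAt_cauchyMoment (ν : Measure ℝ) [IsFiniteMeasure ν] {z w : ℂ} (hz : z ∈ Omega)
    (hw : w ∈ Omega) (a b : ℕ) :
    HasFDerivAt (fun p : ℂ × ℂ => cauchyMoment ν a b p.1 p.2)
      ((a * cauchyMoment ν (a + 1) b z w) • ContinuousLinearMap.fst ℂ ℂ ℂ
        + (b * cauchyMoment ν a (b + 1) z w) • ContinuousLinearMap.snd ℂ ℂ ℂ) (z, w) := by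
  set s : Set (ℂ × ℂ) := {p | |z.im| / 2 < |p.1.im| ∧ |w.im| / 2 < |p.2.im|}
  have hz' : 0 < |z.im| := abs_pos.2 hz
  have hw' : 0 < |w.im| := abs_pos.2 hw
  have hsopen : IsOpen s := by
    apply IsOpen.and
    · exact isOpen_lt continuous_const (by fun_prop)
    · exact isOpen_lt continuous_const (by fun_prop)
  have hsn : s ∈ 𝓝 (z, w) := hsopen.mem_nhds ⟨half_lt_self hz', half_lt_self hw'⟩
  have hs1 : ∀ p ∈ s, p.1 ∈ Omega := fun p hp h => by
    have := hp.1
    rw [h, abs_zero] at this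
    linarith
  have hs2 : ∀ p ∈ s, p.2 ∈ Omega := fun p hp h => by
    have := hp.2
    rw [h, abs_zero] at this
    linarith
  rw [← integral_kernelFDeriv ν hz hw]
  refine hasFDerivAt_integral_of_dominated_of_fderiv_le
    (F := fun (p : ℂ × ℂ) (x : ℝ) => ((x : ℂ) - p.1)⁻¹ ^ a * ((x : ℂ) - p.2)⁻¹ ^ b)
    (bound := fun _ => (a : ℝ) * ((|z.im| / 2)⁻¹ ^ (a + 1) * (|w.im| / 2)⁻¹ ^ b)
      + b * ((|z.im| / 2)⁻¹ ^ a * (|w.im| / 2)⁻¹ ^ (b + 1)))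
    hsn ?_ (integrable_kernel ν hz hw a b)
    (continuous_kernelFDeriv hz hw a b).aestronglyMeasurable ?_
    (integrable_const _) ?_
  · filter_upwards [hsn] with p hp
    exact (continuous_kernel (hs1 p hp) (hs2 p hp) a b).aestronglyMeasurable
  · refine Eventually.of_forall fun x p hp => ?_
    have b1 : |p.1.im|⁻¹ ≤ (|z.im| / 2)⁻¹ := inv_anti₀ (by positivity) hp.1.le
    have b2 : |p.2.im|⁻¹ ≤ (|w.im| / 2)⁻¹ := inv_anti₀ (by positivity) hp.2.le
    refine (norm_kernelFDeriv_le (hs1 p hp) (hs2 p hp) a b x).trans ?_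
    gcongr
  · exact Eventually.of_forall fun x p hp => hasFDerivAt_kernel (hs1 p hp) (hs2 p hp) a b x

lemma differentiableAt_cauchyMoment (ν : Measure ℝ) [IsFiniteMeasure ν] {z w : ℂ}
    (hz : z ∈ Omega) (hw : w ∈ Omega) (a b : ℕ) :
    DifferentiableAt ℂ (fun p : ℂ × ℂ => cauchyMoment ν a b p.1 p.2) (z, w) :=
  (hasFDerivAt_cauchyMoment ν hz hw a b).differentiableAt

lemma hasDerivAt_cauchyMoment (ν : Measure ℝ) [IsFiniteMeasure ν] {z : ℂ} (hz : z ∈ Omega)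
    (a : ℕ) :
    HasDerivAt (fun ζ => cauchyMoment ν a 0 ζ ζ) (a * cauchyMoment ν (a + 1) 0 z z) z := by
  have hd : HasDerivAt (fun ζ : ℂ => (ζ, ζ)) ((1 : ℂ), (1 : ℂ)) z :=
    (hasDerivAt_id z).prodMk (hasDerivAt_id z)
  have h := HasFDerivAt.comp_hasDerivAt (l := fun p : ℂ × ℂ => cauchyMoment ν a 0 p.1 p.2)
    (f := fun ζ : ℂ => (ζ, ζ)) z (hasFDerivAt_cauchyMoment ν hz hz a 0) hd
  refine h.congr_deriv ?_
  simp

lemma hasDerivAt_stieltjes (ν : Measure ℝ) [IsFiniteMeasure ν] {z : ℂ} (hz : z ∈ Omega) :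
    HasDerivAt (stieltjes ν) (cauchyMoment ν 2 0 z z) z := by
  have h := hasDerivAt_cauchyMoment ν hz 1
  have e : stieltjes ν = fun ζ => cauchyMoment ν 1 0 ζ ζ :=
    funext fun ζ => stieltjes_eq ν ζ ζ
  rw [e]
  simpa using h

lemma deriv_stieltjes (ν : Measure ℝ) [IsFiniteMeasure ν] {z : ℂ} (hz : z ∈ Omega) :
    deriv (stieltjes ν) z = cauchyMoment ν 2 0 z z :=
  (hasDerivAt_stieltjes ν hz).deriv

/-- The divided difference relation between the moments (the resolvent identity). -/
lemma cauchyMoment_succ_sub (ν : Measure ℝ) [IsFiniteMeasure ν] {z w : ℂ} (hz : z ∈ Omega)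
    (hw : w ∈ Omega) (a b : ℕ) :
    cauchyMoment ν (a + 1) b z w - cauchyMoment ν a (b + 1) z w
      = (z - w) * cauchyMoment ν (a + 1) (b + 1) z w := by
  unfold cauchyMoment
  rw [← integral_sub (integrable_kernel ν hz hw _ _) (integrable_kernel ν hz hw _ _),
    ← integral_const_mul]
  congr 1
  ext x
  have h1 := ofReal_sub_ne_zero hz x
  have h2 := ofReal_sub_ne_zero hw x
  have h3 : ((x : ℂ) - z)⁻¹ - ((x : ℂ) - w)⁻¹
      = (z - w) * (((x : ℂ) - z)⁻¹ * ((x : ℂ) - w)⁻¹) := by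
    field_simp
    ring
  linear_combination ((x : ℂ) - z)⁻¹ ^ a * ((x : ℂ) - w)⁻¹ ^ b * h3

lemma stieltjes_sub (ν : Measure ℝ) [IsFiniteMeasure ν] {z w : ℂ} (hz : z ∈ Omega)
    (hw : w ∈ Omega) :
    stieltjes ν z - stieltjes ν w = (z - w) * cauchyMoment ν 1 1 z w := by
  rw [← cauchyMoment_succ_sub ν hz hw 0 0, stieltjes_eq ν z w]
  simp [stieltjes, cauchyMoment]

/-- The Stieltjes transform preserves the upper and the lower half-plane. -/
lemma im_mul_stieltjes_im_nonneg (ν : Measure ℝ) [IsFiniteMeasure ν] {z : ℂ} (hz : z ∈ Omega) :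
    0 ≤ z.im * (stieltjes ν z).im := by
  have hint : Integrable (fun x : ℝ => 1 / ((x : ℂ) - z)) ν := by
    simpa using integrable_kernel ν hz hz 1 0
  have h : (stieltjes ν z).im = ∫ x : ℝ, (1 / ((x : ℂ) - z)).im ∂ν := by
    have := integral_im (𝕜 := ℂ) hint
    exact this.symm
  rw [h, ← integral_const_mul]
  refine integral_nonneg fun x => ?_
  simp only [one_div, Complex.inv_im, Complex.sub_im, Complex.ofReal_im, zero_sub, neg_neg]
  have := Complex.normSq_nonneg ((x : ℂ) - z)
  rw [← mul_div_assoc]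
  exact div_nonneg (mul_self_nonneg _) this

/-! ### Separately holomorphic functions along curves -/

/-- A continuous function that is holomorphic in its last variable is strictly differentiable
in that variable, uniformly in the parameter: near `p₀` the function `F p` is uniformly close to
`F p₀`, and Cauchy's estimate turns this into closeness of the difference quotients. -/
lemma isLittleO_sub_sub_deriv {P : Type*} [TopologicalSpace P] {F : P → ℂ → ℂ} {p₀ : P} {z₀ : ℂ}
    (hc : ∀ᶠ q in 𝓝 (p₀, z₀), ContinuousAt (fun q : P × ℂ => F q.1 q.2) q)
    (hd : ∀ᶠ q in 𝓝 (p₀, z₀), DifferentiableAt ℂ (F q.1) q.2) :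
    (fun q : P × ℂ × ℂ => F q.1 q.2.1 - F q.1 q.2.2 - deriv (F p₀) z₀ * (q.2.1 - q.2.2))
      =o[𝓝 (p₀, z₀, z₀)] fun q => q.2.1 - q.2.2 := by
  have h := hc.and hd
  rw [nhds_prod_eq, Filter.eventually_prod_iff] at h
  obtain ⟨pa, hpa, pb, hpb, h⟩ := h
  obtain ⟨R, hR, hRb⟩ := Metric.nhds_basis_closedBall.mem_iff.1 hpb
  have hp₀ : pa p₀ := hpa.self_of_nhds
  have hdiff : ∀ p, pa p → ∀ z ∈ Metric.closedBall z₀ R, DifferentiableAt ℂ (F p) z :=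
    fun p hp z hz => (h hp (hRb hz)).2
  have hcont : ContinuousOn (fun q : P × ℂ => F q.1 q.2)
      ({p | pa p} ×ˢ Metric.closedBall z₀ R) := fun q hq =>
    (h hq.1 (hRb hq.2)).1.continuousWithinAt
  have hstrict : HasStrictDerivAt (F p₀) (deriv (F p₀) z₀) z₀ := by
    have hdo : DifferentiableOn ℂ (F p₀) (Metric.closedBall z₀ R) := fun z hz =>
      (hdiff p₀ hp₀ z hz).differentiableWithinAt
    exact (hdo.analyticAt (Metric.closedBall_mem_nhds z₀ hR)).hasStrictDerivAt
  rw [Asymptotics.isLittleO_iff]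
  intro c hc0
  have e1 : ∀ᶠ q : P × ℂ × ℂ in 𝓝 (p₀, z₀, z₀),
      ‖F p₀ q.2.1 - F p₀ q.2.2 - deriv (F p₀) z₀ * (q.2.1 - q.2.2)‖
        ≤ c / 2 * ‖q.2.1 - q.2.2‖ := by
    have := (Asymptotics.isLittleO_iff.1 hstrict.isLittleO) (half_pos hc0)
    have h2 := (continuous_snd (X := P) (Y := ℂ × ℂ)).continuousAt (x := (p₀, z₀, z₀))
      |>.eventually this
    filter_upwards [h2] with q hq
    simpa [mul_comm] using hq
  set ε : ℝ := c / 2 * (R / 2) with hε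
  have hε0 : 0 < ε := by positivity
  have e2 : ∀ᶠ p in 𝓝 p₀, ∀ z ∈ Metric.closedBall z₀ R, dist (F p z) (F p₀ z) < ε := by
    obtain ⟨v, hv, hv'⟩ := (isCompact_closedBall z₀ R).mem_uniformity_of_prod (f := F)
      (s := {p | pa p}) hcont hp₀ (Metric.dist_mem_uniformity hε0)
    have hs : {p | pa p} ∈ 𝓝 p₀ := hpa
    rw [nhdsWithin_eq_nhds.2 hs] at hv
    filter_upwards [hv] with p hp z hz
    exact hv' p hp z hz
  have e3 : ∀ᶠ q : P × ℂ × ℂ in 𝓝 (p₀, z₀, z₀),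
      q.2.1 ∈ Metric.ball z₀ (R / 2) ∧ q.2.2 ∈ Metric.ball z₀ (R / 2) := by
    have hb : Metric.ball z₀ (R / 2) ∈ 𝓝 z₀ := Metric.ball_mem_nhds _ (half_pos hR)
    have c1 : Tendsto (fun q : P × ℂ × ℂ => q.2.1) (𝓝 (p₀, z₀, z₀)) (𝓝 z₀) :=
      Continuous.tendsto (by fun_prop : Continuous fun q : P × ℂ × ℂ => q.2.1) _
    have c2 : Tendsto (fun q : P × ℂ × ℂ => q.2.2) (𝓝 (p₀, z₀, z₀)) (𝓝 z₀) :=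
      Continuous.tendsto (by fun_prop : Continuous fun q : P × ℂ × ℂ => q.2.2) _
    exact (c1.eventually hb).and (c2.eventually hb)
  have e4 : ∀ᶠ q : P × ℂ × ℂ in 𝓝 (p₀, z₀, z₀), pa q.1 ∧
      ∀ z ∈ Metric.closedBall z₀ R, dist (F q.1 z) (F p₀ z) < ε :=
    (continuous_fst (X := P) (Y := ℂ × ℂ)).continuousAt (x := (p₀, z₀, z₀))
      |>.eventually (hpa.and e2)
  filter_upwards [e1, e3, e4] with q h1 h3 h4
  obtain ⟨h4a, h4⟩ := h4
  have hsub : ∀ ζ ∈ Metric.ball z₀ (R / 2),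
      Metric.closedBall ζ (R / 2) ⊆ Metric.closedBall z₀ R := fun ζ hζ =>
    Metric.closedBall_subset_closedBall' (by
      have := Metric.mem_ball.1 hζ
      linarith)
  have hball : Metric.ball z₀ (R / 2) ⊆ Metric.closedBall z₀ R :=
    (Metric.ball_subset_ball (by linarith)).trans Metric.ball_subset_closedBall
  have hE : ∀ ζ ∈ Metric.closedBall z₀ R,
      DifferentiableAt ℂ (fun ζ => F q.1 ζ - F p₀ ζ) ζ := fun ζ hζ =>
    (hdiff q.1 h4a ζ hζ).sub (hdiff p₀ hp₀ ζ hζ)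
  have hbound : ∀ ζ ∈ Metric.ball z₀ (R / 2), ‖deriv (fun ζ => F q.1 ζ - F p₀ ζ) ζ‖ ≤ c / 2 := by
    intro ζ hζ
    have := Complex.norm_deriv_le_of_forall_mem_sphere_norm_le (c := ζ) (C := ε) (half_pos hR)
      (f := fun ζ => F q.1 ζ - F p₀ ζ)
      (DifferentiableOn.diffContOnCl_ball (U := Metric.closedBall z₀ R)
        (fun w hw => (hE w hw).differentiableWithinAt) (hsub ζ hζ))
      (fun w hw => by
        rw [← dist_eq_norm]
        exact (h4 w (hsub ζ hζ (Metric.sphere_subset_closedBall hw))).le)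
    refine this.trans (le_of_eq ?_)
    rw [hε]
    field_simp
  have h5 := (convex_ball z₀ (R / 2)).norm_image_sub_le_of_norm_deriv_le
    (fun ζ hζ => hE ζ (hball hζ)) hbound h3.2 h3.1
  calc ‖F q.1 q.2.1 - F q.1 q.2.2 - deriv (F p₀) z₀ * (q.2.1 - q.2.2)‖
      = ‖(F p₀ q.2.1 - F p₀ q.2.2 - deriv (F p₀) z₀ * (q.2.1 - q.2.2))
          + ((F q.1 q.2.1 - F p₀ q.2.1) - (F q.1 q.2.2 - F p₀ q.2.2))‖ := by congr 1; ring
    _ ≤ c / 2 * ‖q.2.1 - q.2.2‖ + c / 2 * ‖q.2.1 - q.2.2‖ :=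
        (norm_add_le _ _).trans (add_le_add h1 h5)
    _ = c * ‖q.2.1 - q.2.2‖ := by ring

/-- Chain rule along a curve for a continuous function of a real variable and several complex
variables of which only the partial derivatives are known to exist: in the complex variables
separately everywhere nearby, in the real variable at the base point. -/
theorem hasDerivAt_along_curve {ι : Type*} [Fintype ι] [DecidableEq ι] {F : ℝ → (ι → ℂ) → ℂ}
    {t₀ : ℝ} {x₀ : ι → ℂ}
    (hc : ∀ᶠ q in 𝓝 (t₀, x₀), ContinuousAt (fun q : ℝ × (ι → ℂ) => F q.1 q.2) q)
    (hd : ∀ᶠ q : ℝ × (ι → ℂ) in 𝓝 (t₀, x₀), ∀ j,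
      DifferentiableAt ℂ (fun ζ => F q.1 (Function.update q.2 j ζ)) (q.2 j))
    {c : ℂ} (ht : HasDerivAt (fun τ => F τ x₀) c t₀)
    {x : ℝ → ι → ℂ} {v : ι → ℂ} (hx : ∀ j, HasDerivAt (fun τ => x τ j) (v j) t₀)
    (hx₀ : x t₀ = x₀) :
    HasDerivAt (fun τ => F τ (x τ))
      (c + ∑ j, v j * deriv (fun ζ => F t₀ (Function.update x₀ j ζ)) (x₀ j)) t₀ := by
  suffices H : ∀ s : Finset ι, HasDerivAt (fun τ => F τ (s.piecewise (x τ) x₀))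
      (c + ∑ j ∈ s, v j * deriv (fun ζ => F t₀ (Function.update x₀ j ζ)) (x₀ j)) t₀ by
    simpa using H Finset.univ
  intro s
  induction s using Finset.induction_on with
  | empty => simpa using ht
  | insert j s hj ih =>
    set D := deriv (fun ζ => F t₀ (Function.update x₀ j ζ)) (x₀ j)
    set y : ℝ → ι → ℂ := fun τ => s.piecewise (x τ) x₀ with hy
    have hy₀ : y t₀ = x₀ := by
      simp only [hy, hx₀]
      exact Finset.piecewise_same s x₀
    have hyc : ContinuousAt y t₀ := by
      rw [continuousAt_pi]
      intro i
      by_cases hi : i ∈ s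
      · simpa [hy, Finset.piecewise_eq_of_mem _ _ _ hi] using (hx i).continuousAt
      · simpa [hy, Finset.piecewise_eq_of_notMem _ _ _ hi] using continuousAt_const
    have hm : Continuous fun q : (ℝ × (ι → ℂ)) × ℂ => (q.1.1, Function.update q.1.2 j q.2) := by
      fun_prop
    have hm₀ : Tendsto (fun q : (ℝ × (ι → ℂ)) × ℂ => (q.1.1, Function.update q.1.2 j q.2))
        (𝓝 ((t₀, x₀), x₀ j)) (𝓝 (t₀, x₀)) := by
      have := hm.tendsto ((t₀, x₀), x₀ j)
      simpa using this
    have key := isLittleO_sub_sub_deriv (P := ℝ × (ι → ℂ)) (p₀ := (t₀, x₀)) (z₀ := x₀ j)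
      (F := fun p ζ => F p.1 (Function.update p.2 j ζ))
      (by
        filter_upwards [hm₀.eventually hc] with q hq
        exact ContinuousAt.comp (f := fun q : (ℝ × (ι → ℂ)) × ℂ =>
          (q.1.1, Function.update q.1.2 j q.2)) hq hm.continuousAt)
      (by
        filter_upwards [hm₀.eventually hd] with q hq
        simpa using hq j)
    have htend : Tendsto (fun τ => ((τ, y τ), x τ j, x₀ j)) (𝓝 t₀)
        (𝓝 ((t₀, x₀), x₀ j, x₀ j)) := by
      have h1 : Tendsto y (𝓝 t₀) (𝓝 x₀) := by simpa [hy₀] using hyc.tendsto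
      have h2 : Tendsto (fun τ => x τ j) (𝓝 t₀) (𝓝 (x₀ j)) := by
        simpa [hx₀] using (hx j).continuousAt.tendsto
      exact (tendsto_id.prodMk_nhds h1).prodMk_nhds (h2.prodMk_nhds tendsto_const_nhds)
    have k1 := key.comp_tendsto htend
    have k2 : (fun τ => x τ j - x₀ j) =O[𝓝 t₀] fun τ => τ - t₀ := by
      have := (hx j).isBigO_sub
      rwa [hx₀] at this
    have k3 := k1.trans_isBigO k2
    have hins : ∀ τ, (insert j s).piecewise (x τ) x₀ = Function.update (y τ) j (x τ j) := by
      intro τ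
      simp [hy, Finset.piecewise_insert]
    have hyj : ∀ τ, Function.update (y τ) j (x₀ j) = y τ := by
      intro τ
      rw [Function.update_eq_self_iff]
      simp [hy, hj]
    have h0 : HasDerivAt (fun τ => F τ (Function.update (y τ) j (x τ j)) - F τ (y τ)
        - D * (x τ j - x₀ j)) 0 t₀ := by
      rw [hasDerivAt_iff_isLittleO]
      refine k3.congr (fun τ => ?_) (fun τ => rfl)
      have : Function.update x₀ j (x₀ j) = x₀ := by simp
      simp [hyj, hy₀, hx₀, D]
    have h1 := (h0.add (((hx j).sub_const (x₀ j)).const_mul D)).add ih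
    rw [Finset.sum_insert hj]
    refine (h1.congr_of_eventuallyEq (Eventually.of_forall fun τ => ?_)).congr_deriv ?_
    · simp only [hins, Pi.add_apply]
      ring
    · ring

/-- The case of a single complex variable of `hasDerivAt_along_curve`. -/
lemma hasDerivAt_along_curve_one {F : ℝ → ℂ → ℂ} {t₀ : ℝ} {z₀ : ℂ}
    (hc : ∀ᶠ q in 𝓝 (t₀, z₀), ContinuousAt (fun q : ℝ × ℂ => F q.1 q.2) q)
    (hd : ∀ᶠ q : ℝ × ℂ in 𝓝 (t₀, z₀), DifferentiableAt ℂ (F q.1) q.2)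
    {c : ℂ} (ht : HasDerivAt (fun τ => F τ z₀) c t₀)
    {x : ℝ → ℂ} {v : ℂ} (hx : HasDerivAt x v t₀) (hx₀ : x t₀ = z₀) :
    HasDerivAt (fun τ => F τ (x τ)) (c + v * deriv (F t₀) z₀) t₀ := by
  have hm : Continuous fun q : ℝ × (Unit → ℂ) => (q.1, q.2 ()) := by fun_prop
  have hm₀ := hm.tendsto (t₀, fun _ => z₀)
  have := hasDerivAt_along_curve (ι := Unit) (F := fun τ y => F τ (y ())) (x₀ := fun _ => z₀)
    (x := fun τ _ => x τ) (v := fun _ => v) (t₀ := t₀) (c := c)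
    (by
      filter_upwards [hm₀.eventually hc] with q hq
      exact ContinuousAt.comp (f := fun q : ℝ × (Unit → ℂ) => (q.1, q.2 ())) hq
        hm.continuousAt)
    (by
      filter_upwards [hm₀.eventually hd] with q hq j
      simpa using hq)
    ht (fun _ => hx) (funext fun _ => hx₀)
  simpa using this

/-! ### A Grönwall lemma for linear equations -/

/-- Two-sided bound behind uniqueness for `δ' = κ δ`: the function `‖δ‖² e^{-2Kτ}` decreases
and `‖δ‖² e^{2Kτ}` increases. -/
lemma norm_sq_mul_exp_antitone_monotone {δ κ : ℝ → ℂ} {a b K : ℝ}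
    (hcont : ContinuousOn δ (Icc a b))
    (hder : ∀ τ ∈ Ioo a b, HasDerivAt δ (κ τ * δ τ) τ) (hK : ∀ τ ∈ Ioo a b, ‖κ τ‖ ≤ K) :
    AntitoneOn (fun τ => ‖δ τ‖ ^ 2 * Real.exp (-(2 * K) * τ)) (Icc a b) ∧
      MonotoneOn (fun τ => ‖δ τ‖ ^ 2 * Real.exp (2 * K * τ)) (Icc a b) := by
  have hcont' : ∀ C : ℝ, ContinuousOn (fun τ => ‖δ τ‖ ^ 2 * Real.exp (C * τ)) (Icc a b) :=
    fun C => (hcont.norm.pow 2).mul (by fun_prop)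
  have hderiv : ∀ C : ℝ, ∀ τ ∈ Ioo a b, HasDerivAt (fun τ => ‖δ τ‖ ^ 2 * Real.exp (C * τ))
      ((2 * inner ℝ (δ τ) (κ τ * δ τ) + C * ‖δ τ‖ ^ 2) * Real.exp (C * τ)) τ := by
    intro C τ hτ
    have h1 := (hder τ hτ).norm_sq
    have h2 : HasDerivAt (fun τ => Real.exp (C * τ)) (Real.exp (C * τ) * (C * 1)) τ :=
      ((hasDerivAt_id τ).const_mul C).exp
    refine (h1.fun_mul h2).congr_deriv ?_
    ring
  have hinner : ∀ τ ∈ Ioo a b, |inner ℝ (δ τ) (κ τ * δ τ)| ≤ K * ‖δ τ‖ ^ 2 := by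
    intro τ hτ
    refine (abs_real_inner_le_norm _ _).trans ?_
    rw [norm_mul]
    nlinarith [mul_le_mul_of_nonneg_right (hK τ hτ) (sq_nonneg ‖δ τ‖)]
  constructor
  · refine antitoneOn_of_deriv_nonpos (convex_Icc a b) (hcont' _) ?_ ?_
    · rw [interior_Icc]
      exact fun τ hτ => (hderiv _ τ hτ).differentiableAt.differentiableWithinAt
    · rw [interior_Icc]
      intro τ hτ
      rw [(hderiv _ τ hτ).deriv]
      refine mul_nonpos_of_nonpos_of_nonneg ?_ (Real.exp_pos _).le
      linarith [(abs_le.1 (hinner τ hτ)).2]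
  · refine monotoneOn_of_deriv_nonneg (convex_Icc a b) (hcont' _) ?_ ?_
    · rw [interior_Icc]
      exact fun τ hτ => (hderiv _ τ hτ).differentiableAt.differentiableWithinAt
    · rw [interior_Icc]
      intro τ hτ
      rw [(hderiv _ τ hτ).deriv]
      refine mul_nonneg ?_ (Real.exp_pos _).le
      linarith [(abs_le.1 (hinner τ hτ)).1]

lemma eq_zero_right_of_linear_ode {δ κ : ℝ → ℂ} {a b K : ℝ} (hab : a ≤ b)
    (hcont : ContinuousOn δ (Icc a b))
    (hder : ∀ τ ∈ Ioo a b, HasDerivAt δ (κ τ * δ τ) τ) (hK : ∀ τ ∈ Ioo a b, ‖κ τ‖ ≤ K)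
    (h : δ a = 0) : δ b = 0 := by
  have := (norm_sq_mul_exp_antitone_monotone hcont hder hK).1
    (left_mem_Icc.2 hab) (right_mem_Icc.2 hab) hab
  simp only [h, norm_zero, ne_eq, OfNat.ofNat_ne_zero, not_false_eq_true, zero_pow,
    zero_mul] at this
  have h2 := nonpos_of_mul_nonpos_left this (Real.exp_pos _)
  simpa using le_antisymm h2 (sq_nonneg _)

lemma eq_zero_left_of_linear_ode {δ κ : ℝ → ℂ} {a b K : ℝ} (hab : a ≤ b)
    (hcont : ContinuousOn δ (Icc a b))
    (hder : ∀ τ ∈ Ioo a b, HasDerivAt δ (κ τ * δ τ) τ) (hK : ∀ τ ∈ Ioo a b, ‖κ τ‖ ≤ K)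
    (h : δ b = 0) : δ a = 0 := by
  have := (norm_sq_mul_exp_antitone_monotone hcont hder hK).2
    (left_mem_Icc.2 hab) (right_mem_Icc.2 hab) hab
  simp only [h, norm_zero, ne_eq, OfNat.ofNat_ne_zero, not_false_eq_true, zero_pow,
    zero_mul] at this
  have h2 := nonpos_of_mul_nonpos_left this (Real.exp_pos _)
  simpa using le_antisymm h2 (sq_nonneg _)

/-! ### The characteristics of the equation for the Stieltjes transform -/

/-- The point at time `τ` of the characteristic of `M_t = (2σ²M + z) M_z + M` that passes through
`z` at time `t`. -/
def charPath (σ : ℝ) (X : ℝ → Measure ℝ) (t τ : ℝ) (z : ℂ) : ℂ :=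
  (Real.exp (t - τ) : ℂ) * z
    + (σ : ℂ) ^ 2 * ((Real.exp (t - τ) : ℂ) - (Real.exp (τ - t) : ℂ)) * stieltjes (X t) z

lemma charPath_self (σ : ℝ) (X : ℝ → Measure ℝ) (t : ℝ) (z : ℂ) : charPath σ X t t z = z := by
  simp [charPath]

lemma hasDerivAt_exp_sub_const (t τ : ℝ) :
    HasDerivAt (fun τ : ℝ => (Real.exp (τ - t) : ℂ)) (Real.exp (τ - t) : ℂ) τ := by
  have h : HasDerivAt (fun τ : ℝ => Real.exp (τ - t)) (Real.exp (τ - t) * 1) τ :=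
    ((hasDerivAt_id τ).sub_const t).exp
  simpa using h.ofReal_comp

lemma hasDerivAt_exp_const_sub (t τ : ℝ) :
    HasDerivAt (fun τ : ℝ => (Real.exp (t - τ) : ℂ)) (-(Real.exp (t - τ) : ℂ)) τ := by
  have h : HasDerivAt (fun τ : ℝ => Real.exp (t - τ)) (Real.exp (t - τ) * (-1)) τ :=
    ((hasDerivAt_id τ).const_sub t).exp
  simpa using h.ofReal_comp

lemma exp_sub_mul_exp_sub (a b : ℝ) : (Real.exp (a - b) : ℂ) * (Real.exp (b - a) : ℂ) = 1 := by
  rw [← Complex.ofReal_mul, ← Real.exp_add]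
  simp

lemma hasDerivAt_charPath (σ : ℝ) (X : ℝ → Measure ℝ) (t τ : ℝ) (z : ℂ) :
    HasDerivAt (fun τ => charPath σ X t τ z)
      (-(charPath σ X t τ z + 2 * (σ : ℂ) ^ 2 * ((Real.exp (τ - t) : ℂ) * stieltjes (X t) z)))
      τ := by
  have h1 := hasDerivAt_exp_const_sub t τ
  have h2 := hasDerivAt_exp_sub_const t τ
  refine ((h1.mul_const z).fun_add (((h1.fun_sub h2).const_mul ((σ : ℂ) ^ 2)).mul_const
    (stieltjes (X t) z))).congr_deriv ?_
  unfold charPath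
  ring

namespace IsLimitProcess

variable {σ : ℝ} {X : ℝ → Measure ℝ}

lemma abs_im_le_charPath (hX : IsLimitProcess σ X) {t τ : ℝ} (ht : 0 ≤ t) (h : τ ≤ t)
    {z : ℂ} (hz : z ∈ Omega) :
    |z.im| ≤ |(charPath σ X t τ z).im| := by
  have := hX.isProbabilityMeasure t ht
  have hm := im_mul_stieltjes_im_nonneg (X t) hz
  have e1 : 1 ≤ Real.exp (t - τ) := Real.one_le_exp (by linarith)
  have e2 : Real.exp (τ - t) ≤ 1 := Real.exp_le_one_iff.2 (by linarith)
  have him : (charPath σ X t τ z).im = Real.exp (t - τ) * z.im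
      + σ ^ 2 * (Real.exp (t - τ) - Real.exp (τ - t)) * (stieltjes (X t) z).im := by
    have : charPath σ X t τ z = (Real.exp (t - τ) : ℂ) * z
        + ((σ ^ 2 * (Real.exp (t - τ) - Real.exp (τ - t)) : ℝ) : ℂ) * stieltjes (X t) z := by
      unfold charPath
      push_cast
      ring
    rw [this, Complex.add_im, Complex.im_ofReal_mul, Complex.im_ofReal_mul]
  rw [him]
  set e := Real.exp (t - τ)
  set s := σ ^ 2 * (e - Real.exp (τ - t)) with hs
  have hs0 : 0 ≤ s := mul_nonneg (sq_nonneg _) (by linarith)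
  rw [← sq_le_sq]
  have h1 : 0 ≤ e * s * (z.im * (stieltjes (X t) z).im) :=
    mul_nonneg (mul_nonneg (by linarith) hs0) hm
  have h2 : z.im ^ 2 ≤ e ^ 2 * z.im ^ 2 :=
    le_mul_of_one_le_left (sq_nonneg _) (one_le_pow₀ e1)
  nlinarith [sq_nonneg (s * (stieltjes (X t) z).im)]

lemma charPath_mem (hX : IsLimitProcess σ X) {t τ : ℝ} (ht : 0 ≤ t) (h : τ ≤ t)
    {z : ℂ} (hz : z ∈ Omega) :
    charPath σ X t τ z ∈ Omega := by
  have := hX.abs_im_le_charPath ht h hz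
  exact abs_pos.1 ((abs_pos.2 hz).trans_le this)

lemma continuousOn_stieltjes (hX : IsLimitProcess σ X) :
    ContinuousOn (fun q : ℝ × ℂ => stieltjes (X q.1) q.2) (Ici 0 ×ˢ Omega) := by
  rintro ⟨t, z⟩ ⟨ht, hz⟩
  have ht : 0 ≤ t := ht
  have hz : z ∈ Omega := hz
  have htime : ContinuousWithinAt (fun τ => stieltjes (X τ) z) (Ici 0) t := by
    rcases ht.eq_or_lt with rfl | ht'
    · exact hX.initial z hz
    · exact (hX.hasDerivAt t ht' z hz).continuousAt.continuousWithinAt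
  have hfst : Tendsto (fun q : ℝ × ℂ => q.1) (𝓝[Ici 0 ×ˢ Omega] (t, z)) (𝓝[Ici 0] t) :=
    tendsto_nhdsWithin_of_tendsto_nhds_of_eventually_within _
      (continuous_fst.continuousAt.tendsto.mono_left nhdsWithin_le_nhds)
      (eventually_nhdsWithin_of_forall fun q hq => hq.1)
  have h1 : Tendsto (fun q : ℝ × ℂ => stieltjes (X q.1) z) (𝓝[Ici 0 ×ˢ Omega] (t, z))
      (𝓝 (stieltjes (X t) z)) := htime.tendsto.comp hfst
  have h2 : Tendsto (fun q : ℝ × ℂ => stieltjes (X q.1) q.2 - stieltjes (X q.1) z)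
      (𝓝[Ici 0 ×ˢ Omega] (t, z)) (𝓝 0) := by
    have hb : Tendsto (fun q : ℝ × ℂ => ‖q.2 - z‖ * (|q.2.im|⁻¹ * |z.im|⁻¹))
        (𝓝[Ici 0 ×ˢ Omega] (t, z)) (𝓝 0) := by
      have hca : ContinuousAt (fun q : ℝ × ℂ => ‖q.2 - z‖ * (|q.2.im|⁻¹ * |z.im|⁻¹)) (t, z) := by
        have : |((t, z) : ℝ × ℂ).2.im| ≠ 0 := (abs_pos.2 hz).ne'
        refine ContinuousAt.mul (by fun_prop) (ContinuousAt.mul (ContinuousAt.inv₀ ?_ this)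
          continuousAt_const)
        fun_prop
      have := hca.tendsto.mono_left (nhdsWithin_le_nhds (s := Ici (0 : ℝ) ×ˢ Omega))
      simpa using this
    refine squeeze_zero_norm' ?_ hb
    filter_upwards [self_mem_nhdsWithin] with q hq
    have := hX.isProbabilityMeasure q.1 hq.1
    rw [stieltjes_sub (X q.1) hq.2 hz, norm_mul]
    gcongr
    simpa using norm_cauchyMoment_le (X q.1) hq.2 hz 1 1
  have := h1.add h2
  simp only [add_sub_cancel, add_zero] at this
  exact this

lemma hasDerivAt_stieltjes_along (hX : IsLimitProcess σ X) {t : ℝ} (ht : 0 < t)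
    {z : ℂ} (hz : z ∈ Omega) {x : ℝ → ℂ} {v : ℂ}
    (hx : HasDerivAt x v t) (hxt : x t = z) :
    HasDerivAt (fun τ => stieltjes (X τ) (x τ))
      ((2 * (σ : ℂ) ^ 2 * stieltjes (X t) z + z) * deriv (stieltjes (X t)) z + stieltjes (X t) z
        + v * deriv (stieltjes (X t)) z) t := by
  have hopen : Ioi (0 : ℝ) ×ˢ Omega ∈ 𝓝 (t, z) :=
    (isOpen_Ioi.prod isOpen_Omega).mem_nhds ⟨ht, hz⟩
  refine hasDerivAt_along_curve_one (F := fun τ z => stieltjes (X τ) z) (z₀ := z) ?_ ?_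
    (hX.hasDerivAt t ht z hz) hx hxt
  · filter_upwards [hopen, eventually_mem_nhds_iff.2 hopen] with q hq hq'
    exact (hX.continuousOn_stieltjes.mono
      (prod_mono_left Ioi_subset_Ici_self)).continuousAt hq'
  · filter_upwards [hopen] with q hq
    have := hX.isProbabilityMeasure q.1 (le_of_lt hq.1)
    exact (hasDerivAt_stieltjes (X q.1) hq.2).differentiableAt

/-- The Stieltjes transform grows exponentially along the characteristics. The difference of the
two sides solves a linear equation along the path, which is explicit and stays in `Ω` in the
backward direction of time. -/
lemma stieltjes_charPath (hX : IsLimitProcess σ X) {t τ : ℝ} (hτ : 0 ≤ τ) (h : τ ≤ t)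
    {z : ℂ} (hz : z ∈ Omega) :
    stieltjes (X τ) (charPath σ X t τ z) = (Real.exp (τ - t) : ℂ) * stieltjes (X t) z := by
  have ht : 0 ≤ t := hτ.trans h
  set c := stieltjes (X t) z with hc
  set w : ℝ → ℂ := fun τ => charPath σ X t τ z with hw
  have hwmem : ∀ r ∈ Icc τ t, w r ∈ Omega := fun r hr => hX.charPath_mem ht hr.2 hz
  have hwder : ∀ r, HasDerivAt w
      (-(w r + 2 * (σ : ℂ) ^ 2 * ((Real.exp (r - t) : ℂ) * c))) r := fun r =>
    hasDerivAt_charPath σ X t r z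
  have hzero : stieltjes (X τ) (w τ) - (Real.exp (τ - t) : ℂ) * c = 0 := by
    refine eq_zero_left_of_linear_ode
      (δ := fun r => stieltjes (X r) (w r) - (Real.exp (r - t) : ℂ) * c)
      (κ := fun r => 1 + 2 * (σ : ℂ) ^ 2 * deriv (stieltjes (X r)) (w r))
      (K := 1 + 2 * σ ^ 2 * (|z.im|⁻¹ ^ 2)) h ?_ ?_ ?_ ?_
    · refine ContinuousOn.sub ?_ (by fun_prop)
      refine hX.continuousOn_stieltjes.comp (f := fun r => (r, w r)) ?_ ?_
      · exact continuousOn_id.prodMk fun r _ => (hwder r).continuousAt.continuousWithinAt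
      · exact fun r hr => ⟨hτ.trans hr.1, hwmem r hr⟩
    · intro r hr
      have hr0 : 0 < r := hτ.trans_lt hr.1
      have hwr := hwmem r (Ioo_subset_Icc_self hr)
      have h1 := hX.hasDerivAt_stieltjes_along hr0 hwr (hwder r) rfl
      have h2 := (hasDerivAt_exp_sub_const t r).mul_const c
      refine (h1.fun_sub h2).congr_deriv ?_
      ring
    · intro r hr
      have hr0 : 0 ≤ r := hτ.trans hr.1.le
      have := hX.isProbabilityMeasure r hr0
      have hwr := hwmem r (Ioo_subset_Icc_self hr)
      rw [deriv_stieltjes (X r) hwr]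
      have hn : ‖cauchyMoment (X r) 2 0 (w r) (w r)‖ ≤ |z.im|⁻¹ ^ 2 := by
        refine (norm_cauchyMoment_le (X r) hwr hwr 2 0).trans ?_
        rw [pow_zero, mul_one]
        have := hX.abs_im_le_charPath ht hr.2.le hz (τ := r)
        have h0 := abs_pos.2 hz
        gcongr
      refine (norm_add_le _ _).trans ?_
      rw [norm_one, norm_mul, norm_mul, norm_pow, Complex.norm_real, Real.norm_eq_abs, sq_abs]
      have : ‖(2 : ℂ)‖ = 2 := by simp
      rw [this]
      gcongr
    · simp [hw, charPath_self, hc]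
  exact sub_eq_zero.1 hzero

lemma hTrans_eq (hX : IsLimitProcess σ X) {t t₀ : ℝ} (ht₀ : 0 ≤ t₀) (h : t₀ ≤ t)
    {z : ℂ} (hz : z ∈ Omega) :
    hTrans σ X t t₀ z = charPath σ X t t₀ z := by
  have h0 : hMap σ X t z = charPath σ X t 0 z := by
    simp [hMap, charPath, mul_comm]
  have hM := hX.stieltjes_charPath le_rfl (ht₀.trans h) hz
  rw [hTrans, gMap, h0, hM]
  unfold charPath
  simp only [sub_eq_add_neg, zero_add, Real.exp_add, Real.exp_neg,
    Complex.ofReal_mul, Complex.ofReal_inv, Real.exp_zero, neg_zero, mul_one]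
  have e1 : (Real.exp t : ℂ) ≠ 0 := Complex.ofReal_ne_zero.2 (Real.exp_ne_zero _)
  have e2 : (Real.exp t₀ : ℂ) ≠ 0 := Complex.ofReal_ne_zero.2 (Real.exp_ne_zero _)
  field_simp
  ring

end IsLimitProcess

/-! ### The flow maps -/

/-- The spatial derivative of `charPath`. -/
def charDeriv (σ : ℝ) (X : ℝ → Measure ℝ) (t τ : ℝ) (z : ℂ) : ℂ :=
  (Real.exp (t - τ) : ℂ)
    + (σ : ℂ) ^ 2 * ((Real.exp (t - τ) : ℂ) - (Real.exp (τ - t) : ℂ)) * cauchyMoment (X t) 2 0 z z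

lemma charDeriv_self (σ : ℝ) (X : ℝ → Measure ℝ) (t : ℝ) (z : ℂ) : charDeriv σ X t t z = 1 := by
  simp [charDeriv]

lemma hasDerivAt_charDeriv (σ : ℝ) (X : ℝ → Measure ℝ) (t τ : ℝ) (z : ℂ) :
    HasDerivAt (fun τ => charDeriv σ X t τ z)
      (-(charDeriv σ X t τ z
        + 2 * (σ : ℂ) ^ 2 * ((Real.exp (τ - t) : ℂ) * cauchyMoment (X t) 2 0 z z))) τ := by
  have h1 := hasDerivAt_exp_const_sub t τ
  have h2 := hasDerivAt_exp_sub_const t τ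
  refine (h1.fun_add (((h1.fun_sub h2).const_mul ((σ : ℂ) ^ 2)).mul_const
    (cauchyMoment (X t) 2 0 z z))).congr_deriv ?_
  unfold charDeriv
  ring

namespace IsLimitProcess

variable {σ : ℝ} {X : ℝ → Measure ℝ}

lemma hasDerivAt_charPath_space (hX : IsLimitProcess σ X) {t : ℝ} (ht : 0 ≤ t) (τ : ℝ) {z : ℂ}
    (hz : z ∈ Omega) : HasDerivAt (charPath σ X t τ) (charDeriv σ X t τ z) z := by
  have := hX.isProbabilityMeasure t ht
  have h := ((hasDerivAt_id z).const_mul (Real.exp (t - τ) : ℂ)).add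
    ((hasDerivAt_stieltjes (X t) hz).const_mul
      ((σ : ℂ) ^ 2 * ((Real.exp (t - τ) : ℂ) - (Real.exp (τ - t) : ℂ))))
  refine h.congr_deriv ?_
  simp [charDeriv]

/-- The flow property of the characteristics; `r = t` gives a left inverse of the flow map. -/
lemma charPath_charPath (hX : IsLimitProcess σ X) {t τ : ℝ} (hτ : 0 ≤ τ) (h : τ ≤ t) (r : ℝ)
    {z : ℂ} (hz : z ∈ Omega) :
    charPath σ X τ r (charPath σ X t τ z) = charPath σ X t r z := by
  have hM := hX.stieltjes_charPath hτ h hz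
  rw [charPath, hM, charPath, charPath]
  simp only [sub_eq_add_neg, Real.exp_add, Real.exp_neg, Complex.ofReal_mul, Complex.ofReal_inv]
  have e1 : (Real.exp t : ℂ) ≠ 0 := Complex.ofReal_ne_zero.2 (Real.exp_ne_zero _)
  have e2 : (Real.exp τ : ℂ) ≠ 0 := Complex.ofReal_ne_zero.2 (Real.exp_ne_zero _)
  have e3 : (Real.exp r : ℂ) ≠ 0 := Complex.ofReal_ne_zero.2 (Real.exp_ne_zero _)
  field_simp
  ring

lemma charDeriv_charPath (hX : IsLimitProcess σ X) {t τ : ℝ} (hτ : 0 ≤ τ) (h : τ ≤ t) (r : ℝ)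
    {z : ℂ} (hz : z ∈ Omega) :
    charDeriv σ X τ r (charPath σ X t τ z) * charDeriv σ X t τ z = charDeriv σ X t r z := by
  have ht := hτ.trans h
  have h1 := (hX.hasDerivAt_charPath_space hτ r (hX.charPath_mem ht h hz)).comp z
    (hX.hasDerivAt_charPath_space ht τ hz)
  refine (h1.congr_of_eventuallyEq ?_).unique (hX.hasDerivAt_charPath_space ht r hz)
  filter_upwards [isOpen_Omega.mem_nhds hz] with ζ hζ
  exact (hX.charPath_charPath hτ h r hζ).symm

lemma charDeriv_mul_charDeriv (hX : IsLimitProcess σ X) {t τ : ℝ} (hτ : 0 ≤ τ) (h : τ ≤ t)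
    {z : ℂ} (hz : z ∈ Omega) :
    charDeriv σ X τ t (charPath σ X t τ z) * charDeriv σ X t τ z = 1 := by
  rw [hX.charDeriv_charPath hτ h t hz, charDeriv_self]

lemma charDeriv_ne_zero (hX : IsLimitProcess σ X) {t τ : ℝ} (hτ : 0 ≤ τ) (h : τ ≤ t)
    {z : ℂ} (hz : z ∈ Omega) : charDeriv σ X t τ z ≠ 0 :=
  right_ne_zero_of_mul_eq_one (hX.charDeriv_mul_charDeriv hτ h hz)

lemma charPath_injOn (hX : IsLimitProcess σ X) {t τ : ℝ} (hτ : 0 ≤ τ) (h : τ ≤ t) :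
    InjOn (charPath σ X t τ) Omega := by
  intro z hz w hw hzw
  rw [← charPath_self σ X t z, ← charPath_self σ X t w, ← hX.charPath_charPath hτ h t hz,
    ← hX.charPath_charPath hτ h t hw, hzw]

lemma hTrans_eventuallyEq (hX : IsLimitProcess σ X) {t t₀ : ℝ} (ht₀ : 0 ≤ t₀) (h : t₀ ≤ t)
    {z : ℂ} (hz : z ∈ Omega) : hTrans σ X t t₀ =ᶠ[𝓝 z] charPath σ X t t₀ := by
  filter_upwards [isOpen_Omega.mem_nhds hz] with ζ hζ
  exact hX.hTrans_eq ht₀ h hζ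

lemma hasDerivAt_hTrans (hX : IsLimitProcess σ X) {t t₀ : ℝ} (ht₀ : 0 ≤ t₀) (h : t₀ ≤ t)
    {z : ℂ} (hz : z ∈ Omega) : HasDerivAt (hTrans σ X t t₀) (charDeriv σ X t t₀ z) z :=
  (hX.hasDerivAt_charPath_space (ht₀.trans h) t₀ hz).congr_of_eventuallyEq
    (hX.hTrans_eventuallyEq ht₀ h hz)

end IsLimitProcess

/-! ### Expressing the flow through the initial measure -/

/-- `e^{t₀ - t}`: together with `coeffB` it gives the inverse flow map
`y ↦ coeffA y - coeffB ∫ (x - y)⁻¹ dX_{t₀}(x)`. -/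
def coeffA (t₀ t : ℝ) : ℂ := (Real.exp (t₀ - t) : ℂ)

/-- `σ² (e^{t - t₀} - e^{t₀ - t})`. -/
def coeffB (σ t₀ t : ℝ) : ℂ :=
  (σ : ℂ) ^ 2 * ((Real.exp (t - t₀) : ℂ) - (Real.exp (t₀ - t) : ℂ))

/-- The divided difference of the function `y ↦ a y - b ∫ (x - y)⁻¹ dν(x)`. -/
def invQuot (ν : Measure ℝ) (a b y u : ℂ) : ℂ := a - b * cauchyMoment ν 1 1 y u

/-- With `v` the inverse of `y ↦ a y - b ∫ (x - y)⁻¹ dν(x)`, this is `v'' / v'²` at the point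
with image `y`. -/
def meanKernel (ν : Measure ℝ) (a b y : ℂ) : ℂ :=
  2 * b * cauchyMoment ν 3 0 y y / invQuot ν a b y y

/-- With `v` the inverse of `y ↦ a y - b ∫ (x - y)⁻¹ dν(x)`, this is `(S v)(z, w) / (v'(z) v'(w))`
at the points with images `y = v z` and `u = v w`; the formula covers the diagonal. -/
def covKernel (ν : Measure ℝ) (a b y u : ℂ) : ℂ :=
  b * cauchyMoment ν 2 2 y u / invQuot ν a b y u
    + b ^ 2 * cauchyMoment ν 2 1 y u * cauchyMoment ν 1 2 y u / invQuot ν a b y u ^ 2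

lemma invQuot_diag_left (ν : Measure ℝ) [IsFiniteMeasure ν] (a b : ℂ) {y u : ℂ} (hy : y ∈ Omega)
    (hu : u ∈ Omega) :
    invQuot ν a b y y = invQuot ν a b y u - b * ((y - u) * cauchyMoment ν 2 1 y u) := by
  have h := cauchyMoment_succ_sub ν hy hu 1 0
  norm_num at h
  rw [invQuot, invQuot, cauchyMoment_diag _ 1 1 y u]
  linear_combination -b * h

lemma invQuot_diag_right (ν : Measure ℝ) [IsFiniteMeasure ν] (a b : ℂ) {y u : ℂ} (hy : y ∈ Omega)
    (hu : u ∈ Omega) :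
    invQuot ν a b u u = invQuot ν a b y u + b * ((y - u) * cauchyMoment ν 1 2 y u) := by
  have h := cauchyMoment_succ_sub ν hy hu 0 1
  norm_num [cauchyMoment_zero_left] at h
  rw [invQuot, invQuot, cauchyMoment_diag _ 1 1 u u]
  linear_combination b * h

lemma charDeriv_eq_invQuot (σ : ℝ) (X : ℝ → Measure ℝ) (t₀ t : ℝ) (y : ℂ) :
    charDeriv σ X t₀ t y = invQuot (X t₀) (coeffA t₀ t) (coeffB σ t₀ t) y y := by
  rw [charDeriv, invQuot, cauchyMoment_diag _ 1 1 y y, coeffA, coeffB]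
  ring

lemma charPath_sub_charPath (σ : ℝ) (X : ℝ → Measure ℝ) (t₀ t : ℝ) [IsFiniteMeasure (X t₀)]
    {y u : ℂ} (hy : y ∈ Omega) (hu : u ∈ Omega) :
    charPath σ X t₀ t y - charPath σ X t₀ t u
      = (y - u) * invQuot (X t₀) (coeffA t₀ t) (coeffB σ t₀ t) y u := by
  have h := stieltjes_sub (X t₀) hy hu
  unfold charPath invQuot coeffA coeffB
  linear_combination
    ((σ : ℂ) ^ 2 * ((Real.exp (t₀ - t) : ℂ) - (Real.exp (t - t₀) : ℂ))) * h

lemma hasDerivAt_coeffA (t₀ t : ℝ) : HasDerivAt (coeffA t₀) (-coeffA t₀ t) t :=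
  hasDerivAt_exp_const_sub t₀ t

lemma hasDerivAt_coeffB (σ t₀ t : ℝ) :
    HasDerivAt (coeffB σ t₀) (2 * (σ : ℂ) ^ 2 * (coeffA t₀ t)⁻¹ - coeffB σ t₀ t) t := by
  have h1 := hasDerivAt_exp_const_sub t₀ t
  have h2 := hasDerivAt_exp_sub_const t₀ t
  refine ((h2.fun_sub h1).const_mul ((σ : ℂ) ^ 2)).congr_deriv ?_
  rw [coeffA, inv_eq_of_mul_eq_one_right (exp_sub_mul_exp_sub t₀ t), coeffB]
  ring

lemma coeffA_ne_zero (t₀ t : ℝ) : coeffA t₀ t ≠ 0 := Complex.ofReal_ne_zero.2 (Real.exp_ne_zero _)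

lemma hasDerivAt_invQuot (ν : Measure ℝ) (σ t₀ t : ℝ) (y u : ℂ) :
    HasDerivAt (fun τ => invQuot ν (coeffA t₀ τ) (coeffB σ t₀ τ) y u)
      (-coeffA t₀ t - (2 * (σ : ℂ) ^ 2 * (coeffA t₀ t)⁻¹ - coeffB σ t₀ t)
        * cauchyMoment ν 1 1 y u) t :=
  (hasDerivAt_coeffA t₀ t).fun_sub ((hasDerivAt_coeffB σ t₀ t).mul_const _)

lemma hasDerivAt_meanKernel (ν : Measure ℝ) (σ t₀ t : ℝ) (y : ℂ)
    (hq : invQuot ν (coeffA t₀ t) (coeffB σ t₀ t) y y ≠ 0) :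
    HasDerivAt (fun τ => meanKernel ν (coeffA t₀ τ) (coeffB σ t₀ τ) y)
      (4 * (σ : ℂ) ^ 2 * cauchyMoment ν 3 0 y y
        / invQuot ν (coeffA t₀ t) (coeffB σ t₀ t) y y ^ 2) t := by
  have h := (((hasDerivAt_coeffB σ t₀ t).const_mul 2).mul_const (cauchyMoment ν 3 0 y y)).fun_div
    (hasDerivAt_invQuot ν σ t₀ t y y) hq
  refine h.congr_deriv ?_
  have ha := coeffA_ne_zero t₀ t
  congr 1
  rw [invQuot]
  field_simp
  ring

lemma hasDerivAt_covKernel (ν : Measure ℝ) (σ t₀ t : ℝ) (y u : ℂ)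
    (hq : invQuot ν (coeffA t₀ t) (coeffB σ t₀ t) y u ≠ 0) :
    HasDerivAt (fun τ => covKernel ν (coeffA t₀ τ) (coeffB σ t₀ τ) y u)
      (2 * (σ : ℂ) ^ 2 * (cauchyMoment ν 2 2 y u
          / invQuot ν (coeffA t₀ t) (coeffB σ t₀ t) y u ^ 2
        + 2 * coeffB σ t₀ t * cauchyMoment ν 2 1 y u * cauchyMoment ν 1 2 y u
          / invQuot ν (coeffA t₀ t) (coeffB σ t₀ t) y u ^ 3)) t := by
  have hqd := hasDerivAt_invQuot ν σ t₀ t y u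
  have hb := hasDerivAt_coeffB σ t₀ t
  have h := ((hb.mul_const (cauchyMoment ν 2 2 y u)).fun_div hqd hq).fun_add
    ((((hb.fun_pow 2).mul_const (cauchyMoment ν 2 1 y u)).mul_const
      (cauchyMoment ν 1 2 y u)).fun_div (hqd.fun_pow 2) (pow_ne_zero 2 hq))
  refine h.congr_deriv ?_
  have ha := coeffA_ne_zero t₀ t
  have hQ : coeffB σ t₀ t * cauchyMoment ν 1 1 y u
      = coeffA t₀ t - invQuot ν (coeffA t₀ t) (coeffB σ t₀ t) y u := by
    rw [invQuot]
    ring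
  set q := invQuot ν (coeffA t₀ t) (coeffB σ t₀ t) y u
  set Q := cauchyMoment ν 1 1 y u
  set a := coeffA t₀ t
  set b := coeffB σ t₀ t
  -- the Wronskian-type identity `b' q - b q' = 2 σ²`
  have hw : (2 * (σ : ℂ) ^ 2 * a⁻¹ - b) * q
      - b * (-a - (2 * (σ : ℂ) ^ 2 * a⁻¹ - b) * Q) = 2 * (σ : ℂ) ^ 2 := by
    have : a⁻¹ * a = 1 := inv_mul_cancel₀ ha
    linear_combination (2 * (σ : ℂ) ^ 2 * a⁻¹ - b) * hQ + 2 * (σ : ℂ) ^ 2 * this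
  set b' := 2 * (σ : ℂ) ^ 2 * a⁻¹ - b
  set q' := -a - b' * Q
  rw [← hw]
  field_simp
  ring

/-! ### Derivatives and moments along the flow -/

namespace IsLimitProcess

variable {σ : ℝ} {X : ℝ → Measure ℝ}

lemma invQuot_mul_charDeriv (hX : IsLimitProcess σ X) {t t₀ : ℝ} (ht₀ : 0 ≤ t₀) (h : t₀ ≤ t)
    {z : ℂ} (hz : z ∈ Omega) :
    invQuot (X t₀) (coeffA t₀ t) (coeffB σ t₀ t) (charPath σ X t t₀ z) (charPath σ X t t₀ z)
      * charDeriv σ X t t₀ z = 1 := by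
  rw [← charDeriv_eq_invQuot, hX.charDeriv_mul_charDeriv ht₀ h hz]

lemma sub_eq_mul_invQuot (hX : IsLimitProcess σ X) {t t₀ : ℝ} (ht₀ : 0 ≤ t₀) (h : t₀ ≤ t)
    {z w : ℂ} (hz : z ∈ Omega) (hw : w ∈ Omega) :
    z - w = (charPath σ X t t₀ z - charPath σ X t t₀ w)
      * invQuot (X t₀) (coeffA t₀ t) (coeffB σ t₀ t) (charPath σ X t t₀ z)
        (charPath σ X t t₀ w) := by
  have := hX.isProbabilityMeasure t₀ ht₀
  have ht := ht₀.trans h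
  rw [← charPath_sub_charPath σ X t₀ t (hX.charPath_mem ht h hz) (hX.charPath_mem ht h hw),
    hX.charPath_charPath ht₀ h t hz, hX.charPath_charPath ht₀ h t hw, charPath_self,
    charPath_self]

lemma invQuot_ne_zero (hX : IsLimitProcess σ X) {t t₀ : ℝ} (ht₀ : 0 ≤ t₀) (h : t₀ ≤ t)
    {z w : ℂ} (hz : z ∈ Omega) (hw : w ∈ Omega) :
    invQuot (X t₀) (coeffA t₀ t) (coeffB σ t₀ t) (charPath σ X t t₀ z)
      (charPath σ X t t₀ w) ≠ 0 := by
  rcases eq_or_ne z w with rfl | hne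
  · exact left_ne_zero_of_mul_eq_one (hX.invQuot_mul_charDeriv ht₀ h hz)
  · intro h0
    have := hX.sub_eq_mul_invQuot ht₀ h hz hw
    rw [h0, mul_zero] at this
    exact hne (sub_eq_zero.1 this)

lemma coeffA_mul_stieltjes (hX : IsLimitProcess σ X) {t t₀ : ℝ} (ht₀ : 0 ≤ t₀) (h : t₀ ≤ t)
    {z : ℂ} (hz : z ∈ Omega) :
    coeffA t₀ t * stieltjes (X t) z = stieltjes (X t₀) (charPath σ X t t₀ z) :=
  (hX.stieltjes_charPath ht₀ h hz).symm

lemma coeffA_mul_moment_two (hX : IsLimitProcess σ X) {t t₀ : ℝ} (ht₀ : 0 ≤ t₀) (h : t₀ ≤ t)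
    {z : ℂ} (hz : z ∈ Omega) :
    coeffA t₀ t * cauchyMoment (X t) 2 0 z z
      = cauchyMoment (X t₀) 2 0 (charPath σ X t t₀ z) (charPath σ X t t₀ z)
        * charDeriv σ X t t₀ z := by
  have ht := ht₀.trans h
  have := hX.isProbabilityMeasure t₀ ht₀
  have := hX.isProbabilityMeasure t ht
  have h1 := (hasDerivAt_stieltjes (X t₀) (hX.charPath_mem ht h hz)).comp z
    (hX.hasDerivAt_charPath_space ht t₀ hz)
  refine HasDerivAt.unique ((hasDerivAt_stieltjes (X t) hz).const_mul (coeffA t₀ t))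
    (h1.congr_of_eventuallyEq ?_)
  filter_upwards [isOpen_Omega.mem_nhds hz] with ζ hζ
  exact hX.coeffA_mul_stieltjes ht₀ h hζ

lemma hasDerivAt_charDeriv_space (hX : IsLimitProcess σ X) {t : ℝ} (ht : 0 ≤ t) (t₀ : ℝ)
    {z : ℂ} (hz : z ∈ Omega) :
    HasDerivAt (charDeriv σ X t t₀) (2 * coeffB σ t₀ t * cauchyMoment (X t) 3 0 z z) z := by
  have := hX.isProbabilityMeasure t ht
  refine (((hasDerivAt_cauchyMoment (X t) hz 2).const_mul
    (coeffB σ t₀ t)).const_add (Real.exp (t - t₀) : ℂ)).congr_deriv ?_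
  push_cast
  ring

lemma hasDerivAt_moment_comp (hX : IsLimitProcess σ X) {t t₀ : ℝ} (ht₀ : 0 ≤ t₀) (h : t₀ ≤ t)
    {z : ℂ} (hz : z ∈ Omega) (n : ℕ) :
    HasDerivAt (fun ζ => cauchyMoment (X t₀) n 0 (charPath σ X t t₀ ζ) (charPath σ X t t₀ ζ))
      (n * cauchyMoment (X t₀) (n + 1) 0 (charPath σ X t t₀ z) (charPath σ X t t₀ z)
        * charDeriv σ X t t₀ z) z := by
  have ht := ht₀.trans h
  have := hX.isProbabilityMeasure t₀ ht₀
  exact (hasDerivAt_cauchyMoment (X t₀) (hX.charPath_mem ht h hz) n).comp z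
    (hX.hasDerivAt_charPath_space ht t₀ hz)

lemma moment_three (hX : IsLimitProcess σ X) {t t₀ : ℝ} (ht₀ : 0 ≤ t₀) (h : t₀ ≤ t)
    {z : ℂ} (hz : z ∈ Omega) :
    cauchyMoment (X t) 3 0 z z
      = charDeriv σ X t t₀ z ^ 3
        * cauchyMoment (X t₀) 3 0 (charPath σ X t t₀ z) (charPath σ X t t₀ z) := by
  have ht := ht₀.trans h
  have := hX.isProbabilityMeasure t ht
  have h1 := (hX.hasDerivAt_moment_comp ht₀ h hz 2).fun_mul
    (hX.hasDerivAt_charDeriv_space ht t₀ hz)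
  have h2 := HasDerivAt.unique ((hasDerivAt_cauchyMoment (X t) hz 2).const_mul (coeffA t₀ t))
    (h1.congr_of_eventuallyEq (by
      filter_upwards [isOpen_Omega.mem_nhds hz] with ζ hζ
      exact hX.coeffA_mul_moment_two ht₀ h hζ))
  have h3 := hX.invQuot_mul_charDeriv ht₀ h hz
  rw [invQuot, cauchyMoment_diag _ 1 1 _ (charPath σ X t t₀ z)] at h3
  norm_num at h2 h3
  linear_combination -cauchyMoment (X t) 3 0 z z * h3 + charDeriv σ X t t₀ z / 2 * h2

lemma moment_four (hX : IsLimitProcess σ X) {t t₀ : ℝ} (ht₀ : 0 ≤ t₀) (h : t₀ ≤ t)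
    {z : ℂ} (hz : z ∈ Omega) :
    cauchyMoment (X t) 4 0 z z
      = charDeriv σ X t t₀ z ^ 4
          * cauchyMoment (X t₀) 4 0 (charPath σ X t t₀ z) (charPath σ X t t₀ z)
        + 2 * coeffB σ t₀ t * charDeriv σ X t t₀ z ^ 5
          * cauchyMoment (X t₀) 3 0 (charPath σ X t t₀ z) (charPath σ X t t₀ z) ^ 2 := by
  have ht := ht₀.trans h
  have := hX.isProbabilityMeasure t ht
  have h1 := ((hX.hasDerivAt_charDeriv_space ht t₀ hz).fun_pow 3).fun_mul
    (hX.hasDerivAt_moment_comp ht₀ h hz 3)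
  have h2 := HasDerivAt.unique (hasDerivAt_cauchyMoment (X t) hz 3)
    (h1.congr_of_eventuallyEq (by
      filter_upwards [isOpen_Omega.mem_nhds hz] with ζ hζ
      exact hX.moment_three ht₀ h hζ))
  rw [hX.moment_three ht₀ h hz] at h2
  norm_num at h2
  linear_combination h2 / 3

/-- The moment that drives the covariance, in terms of the initial measure. -/
lemma moment_two_two (hX : IsLimitProcess σ X) {t t₀ : ℝ} (ht₀ : 0 ≤ t₀) (h : t₀ ≤ t)
    {z w : ℂ} (hz : z ∈ Omega) (hw : w ∈ Omega) {y u q : ℂ} (hy : y = charPath σ X t t₀ z)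
    (hu : u = charPath σ X t t₀ w) (hq : q = invQuot (X t₀) (coeffA t₀ t) (coeffB σ t₀ t) y u) :
    cauchyMoment (X t) 2 2 z w
      = charDeriv σ X t t₀ z * charDeriv σ X t t₀ w
        * (cauchyMoment (X t₀) 2 2 y u / q ^ 2
          + 2 * coeffB σ t₀ t * cauchyMoment (X t₀) 2 1 y u * cauchyMoment (X t₀) 1 2 y u
            / q ^ 3) := by
  have ht := ht₀.trans h
  have := hX.isProbabilityMeasure t₀ ht₀
  have := hX.isProbabilityMeasure t ht
  have hq0 : q ≠ 0 := by
    rw [hq, hy, hu]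
    exact hX.invQuot_ne_zero ht₀ h hz hw
  have P1 := hX.invQuot_mul_charDeriv ht₀ h hz
  have P2 := hX.invQuot_mul_charDeriv ht₀ h hw
  rw [← hy] at P1
  rw [← hu] at P2
  rcases eq_or_ne z w with rfl | hne
  · obtain rfl : y = u := hy.trans hu.symm
    rw [← hq] at P1
    rw [cauchyMoment_diag _ 2 2 z z, cauchyMoment_diag _ 2 2 y y, cauchyMoment_diag _ 2 1 y y,
      cauchyMoment_diag _ 1 2 y y, hX.moment_four ht₀ h hz, ← hy,
      eq_inv_of_mul_eq_one_right P1]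
    norm_num
    field_simp
  · have hyo : y ∈ Omega := hy ▸ hX.charPath_mem ht h hz
    have huo : u ∈ Omega := hu ▸ hX.charPath_mem ht h hw
    have hsub := hX.sub_eq_mul_invQuot ht₀ h hz hw
    rw [← hy, ← hu, ← hq] at hsub
    have a1 := hX.coeffA_mul_moment_two ht₀ h hz
    have a2 := hX.coeffA_mul_moment_two ht₀ h hw
    have b1 := hX.coeffA_mul_stieltjes ht₀ h hz
    have b2 := hX.coeffA_mul_stieltjes ht₀ h hw
    rw [← hy] at a1 b1
    rw [← hu] at a2 b2
    have c0 := stieltjes_sub (X t) hz hw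
    have c1 := cauchyMoment_succ_sub (X t) hz hw 1 0
    have c2 := cauchyMoment_succ_sub (X t) hz hw 0 1
    have c3 := cauchyMoment_succ_sub (X t) hz hw 1 1
    have d0 := stieltjes_sub (X t₀) hyo huo
    have d1 := cauchyMoment_succ_sub (X t₀) hyo huo 1 0
    have d2 := cauchyMoment_succ_sub (X t₀) hyo huo 0 1
    have d3 := cauchyMoment_succ_sub (X t₀) hyo huo 1 1
    norm_num [cauchyMoment_zero_left] at c1 c2 c3 d1 d2 d3
    rw [cauchyMoment_zero_right] at c1 d1
    rw [invQuot_diag_left _ _ _ hyo huo, ← hq] at P1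
    rw [invQuot_diag_right _ _ _ hyo huo, ← hq] at P2
    rw [invQuot] at hq
    have hD : y - u ≠ 0 := by
      intro h0
      rw [h0, zero_mul] at hsub
      exact hne (sub_eq_zero.1 hsub)
    have ha := coeffA_ne_zero t₀ t
    set a := coeffA t₀ t
    set b := coeffB σ t₀ t
    set e₁ := charDeriv σ X t t₀ z
    set e₂ := charDeriv σ X t t₀ w
    set D := y - u
    set Q := cauchyMoment (X t₀) 1 1 y u
    set T := cauchyMoment (X t₀) 2 1 y u
    set T' := cauchyMoment (X t₀) 1 2 y u
    set R := cauchyMoment (X t₀) 2 2 y u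
    -- successive divided differences at time `t`, each with its factor `(z - w) = D q` cancelled
    have e11 : a * cauchyMoment (X t) 1 1 z w * q = Q := by
      apply mul_left_cancel₀ hD
      linear_combination b1 - b2 - a * c0 + d0 - a * cauchyMoment (X t) 1 1 z w * hsub
    have e21 : q ^ 2 * cauchyMoment (X t) 2 1 z w = T * e₁ := by
      apply mul_left_cancel₀ (mul_ne_zero ha hD)
      linear_combination -q * a * c1 + q * a1 + q * e₁ * d1 - e11 + Q * P1 + D * T * e₁ * hq
        - a * q * cauchyMoment (X t) 2 1 z w * hsub
    have e12 : q ^ 2 * cauchyMoment (X t) 1 2 z w = T' * e₂ := by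
      apply mul_left_cancel₀ (mul_ne_zero ha hD)
      linear_combination -q * a * c2 - q * a2 + q * e₂ * d2 + e11 - Q * P2 + D * T' * e₂ * hq
        - a * q * cauchyMoment (X t) 1 2 z w * hsub
    have e22 : q ^ 3 * cauchyMoment (X t) 2 2 z w = e₁ * e₂ * (q * R + 2 * b * T * T') := by
      apply mul_left_cancel₀ hD
      linear_combination -q ^ 2 * c3 - q ^ 2 * cauchyMoment (X t) 2 2 z w * hsub + e21 - e12
        - T * e₁ * P2 + T' * e₂ * P1 + q * e₁ * e₂ * d3
    field_simp
    linear_combination e22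

end IsLimitProcess

/-! ### The coefficients of the solution formula -/

namespace IsLimitProcess

variable {σ : ℝ} {X : ℝ → Measure ℝ}

lemma deriv_hTrans (hX : IsLimitProcess σ X) {t t₀ : ℝ} (ht₀ : 0 ≤ t₀) (h : t₀ ≤ t)
    {z : ℂ} (hz : z ∈ Omega) : deriv (hTrans σ X t t₀) z = charDeriv σ X t t₀ z :=
  (hX.hasDerivAt_hTrans ht₀ h hz).deriv

lemma iteratedDeriv_two_hTrans (hX : IsLimitProcess σ X) {t t₀ : ℝ} (ht₀ : 0 ≤ t₀) (h : t₀ ≤ t)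
    {z : ℂ} (hz : z ∈ Omega) :
    iteratedDeriv 2 (hTrans σ X t t₀) z = 2 * coeffB σ t₀ t * cauchyMoment (X t) 3 0 z z := by
  have ht := ht₀.trans h
  rw [iteratedDeriv_succ, iteratedDeriv_one]
  refine HasDerivAt.deriv ((hX.hasDerivAt_charDeriv_space ht t₀ hz).congr_of_eventuallyEq ?_)
  filter_upwards [isOpen_Omega.mem_nhds hz] with ζ hζ
  exact hX.deriv_hTrans ht₀ h hζ

lemma iteratedDeriv_three_hTrans (hX : IsLimitProcess σ X) {t t₀ : ℝ} (ht₀ : 0 ≤ t₀)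
    (h : t₀ ≤ t) {z : ℂ} (hz : z ∈ Omega) :
    iteratedDeriv 3 (hTrans σ X t t₀) z = 6 * coeffB σ t₀ t * cauchyMoment (X t) 4 0 z z := by
  have := hX.isProbabilityMeasure t (ht₀.trans h)
  rw [iteratedDeriv_succ]
  refine HasDerivAt.deriv ((((hasDerivAt_cauchyMoment (X t) hz 3).const_mul
    (2 * coeffB σ t₀ t)).congr_deriv ?_).congr_of_eventuallyEq ?_)
  · norm_num
    ring
  · filter_upwards [isOpen_Omega.mem_nhds hz] with ζ hζ
    exact hX.iteratedDeriv_two_hTrans ht₀ h hζ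

lemma meanCoeff_eq (hX : IsLimitProcess σ X) (β : ℝ) {t t₀ : ℝ} (ht₀ : 0 ≤ t₀) (h : t₀ ≤ t)
    {z : ℂ} (hz : z ∈ Omega) :
    meanCoeff σ β X t t₀ z = charDeriv σ X t t₀ z * (1 / 2 * (2 / (β : ℂ) - 1)
      * meanKernel (X t₀) (coeffA t₀ t) (coeffB σ t₀ t) (charPath σ X t t₀ z)) := by
  have hP := hX.invQuot_mul_charDeriv ht₀ h hz
  have hd := hX.charDeriv_ne_zero ht₀ h hz
  rw [meanCoeff, hX.iteratedDeriv_two_hTrans ht₀ h hz, hX.deriv_hTrans ht₀ h hz,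
    hX.moment_three ht₀ h hz, meanKernel, eq_inv_of_mul_eq_one_left hP]
  field_simp

lemma genSchwarzian_hTrans (hX : IsLimitProcess σ X) {t t₀ : ℝ} (ht₀ : 0 ≤ t₀) (h : t₀ ≤ t)
    {z w : ℂ} (hz : z ∈ Omega) (hw : w ∈ Omega) :
    genSchwarzian (hTrans σ X t t₀) z w
      = charDeriv σ X t t₀ z * charDeriv σ X t t₀ w
        * covKernel (X t₀) (coeffA t₀ t) (coeffB σ t₀ t) (charPath σ X t t₀ z)
          (charPath σ X t t₀ w) := by
  have ht := ht₀.trans h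
  have := hX.isProbabilityMeasure t₀ ht₀
  rcases eq_or_ne z w with rfl | hne
  · have hP := hX.invQuot_mul_charDeriv ht₀ h hz
    have hd := hX.charDeriv_ne_zero ht₀ h hz
    rw [genSchwarzian, if_pos rfl, schwarzian, hX.iteratedDeriv_two_hTrans ht₀ h hz,
      hX.iteratedDeriv_three_hTrans ht₀ h hz, hX.deriv_hTrans ht₀ h hz,
      hX.moment_three ht₀ h hz, hX.moment_four ht₀ h hz, covKernel,
      eq_inv_of_mul_eq_one_left hP]
    set y := charPath σ X t t₀ z
    rw [cauchyMoment_diag _ 2 2 y y, cauchyMoment_diag _ 2 1 y y, cauchyMoment_diag _ 1 2 y y]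
    norm_num
    field_simp
    ring
  · have hyo := hX.charPath_mem ht h hz
    have huo := hX.charPath_mem ht h hw
    have hsub := hX.sub_eq_mul_invQuot ht₀ h hz hw
    have hq0 := hX.invQuot_ne_zero ht₀ h hz hw
    have P1 := hX.invQuot_mul_charDeriv ht₀ h hz
    have P2 := hX.invQuot_mul_charDeriv ht₀ h hw
    rw [genSchwarzian, if_neg hne, hX.deriv_hTrans ht₀ h hz, hX.deriv_hTrans ht₀ h hw,
      hX.hTrans_eq ht₀ h hz, hX.hTrans_eq ht₀ h hw, hsub, covKernel]
    set y := charPath σ X t t₀ z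
    set u := charPath σ X t t₀ w
    have d3 := cauchyMoment_succ_sub (X t₀) hyo huo 1 1
    norm_num at d3
    rw [invQuot_diag_left _ _ _ hyo huo] at P1
    rw [invQuot_diag_right _ _ _ hyo huo] at P2
    have hD : y - u ≠ 0 := by
      intro h0
      rw [h0, zero_mul] at hsub
      exact hne (sub_eq_zero.1 hsub)
    set q := invQuot (X t₀) (coeffA t₀ t) (coeffB σ t₀ t) y u
    set a := coeffA t₀ t
    set b := coeffB σ t₀ t
    set e₁ := charDeriv σ X t t₀ z
    set e₂ := charDeriv σ X t t₀ w
    set D := y - u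
    set T := cauchyMoment (X t₀) 2 1 y u
    set T' := cauchyMoment (X t₀) 1 2 y u
    field_simp
    linear_combination (q + b * (D * T')) * e₂ * P1 + P2 + D * q * b * e₁ * e₂ * d3

end IsLimitProcess

/-- The exponent of the solution formula as a function of the transported variables
`r_j = s_j h'(z_j)` and `y_j = h(z_j)`, which are constant along characteristics, and of the
coefficients `a`, `b` of the inverse flow map. -/
def exponent (β : ℝ) (ν : Measure ℝ) {k : ℕ} (a b : ℂ) (r y : Fin k → ℂ) : ℂ :=
  Complex.I * (∑ j, r j * (1 / 2 * (2 / (β : ℂ) - 1) * meanKernel ν a b (y j)))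
    - 1 / 2 * (∑ j, ∑ l, r j * r l * (2 / (β : ℂ) * covKernel ν a b (y j) (y l)))

/-- The zeroth order coefficient of the equation. -/
def sourceCoeff (σ β : ℝ) (ν : Measure ℝ) {k : ℕ} (s z : Fin k → ℂ) : ℂ :=
  2 * Complex.I * (σ : ℂ) ^ 2 * (2 / (β : ℂ) - 1)
      * (∑ j : Fin k, ∫ x : ℝ, s j / ((x : ℂ) - z j) ^ 3 ∂ν)
    - 2 * (σ : ℂ) ^ 2 / (β : ℂ)
      * (∑ j : Fin k, ∑ l : Fin k,
          ∫ x : ℝ, s j * s l / (((x : ℂ) - z j) ^ 2 * ((x : ℂ) - z l) ^ 2) ∂ν)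

lemma sourceCoeff_eq (σ β : ℝ) (ν : Measure ℝ) {k : ℕ} (s z : Fin k → ℂ) :
    sourceCoeff σ β ν s z
      = 2 * Complex.I * (σ : ℂ) ^ 2 * (2 / (β : ℂ) - 1)
          * (∑ j : Fin k, s j * cauchyMoment ν 3 0 (z j) (z j))
        - 2 * (σ : ℂ) ^ 2 / (β : ℂ)
          * (∑ j : Fin k, ∑ l : Fin k, s j * s l * cauchyMoment ν 2 2 (z j) (z l)) := by
  simp only [sourceCoeff, cauchyMoment, ← integral_const_mul, div_eq_mul_inv, mul_inv, inv_pow,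
    pow_zero, mul_one]

lemma coeffB_self (σ t₀ : ℝ) : coeffB σ t₀ t₀ = 0 := by simp [coeffB]

lemma exponent_zero_right (β : ℝ) (ν : Measure ℝ) {k : ℕ} (a : ℂ) (r y : Fin k → ℂ) :
    exponent β ν a 0 r y = 0 := by
  simp [exponent, meanKernel, covKernel]

namespace IsLimitProcess

variable {σ : ℝ} {X : ℝ → Measure ℝ}

/-- With the transported variables held fixed, the exponent is a primitive of the zeroth order
coefficient of the equation. -/
lemma hasDerivAt_exponent (hX : IsLimitProcess σ X) (β : ℝ) {t t₀ : ℝ} (ht₀ : 0 ≤ t₀)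
    (h : t₀ ≤ t) {k : ℕ} (s : Fin k → ℂ) {z : Fin k → ℂ} (hz : z ∈ OmegaPow k) :
    HasDerivAt (fun τ => exponent β (X t₀) (coeffA t₀ τ) (coeffB σ t₀ τ)
        (fun j => s j * charDeriv σ X t t₀ (z j)) (fun j => charPath σ X t t₀ (z j)))
      (sourceCoeff σ β (X t) s z) t := by
  have h1 : HasDerivAt (fun τ => ∑ j, s j * charDeriv σ X t t₀ (z j)
      * (1 / 2 * (2 / (β : ℂ) - 1) * meanKernel (X t₀) (coeffA t₀ τ) (coeffB σ t₀ τ)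
        (charPath σ X t t₀ (z j))))
      (∑ j, s j * ((2 / (β : ℂ) - 1) * 2 * (σ : ℂ) ^ 2 * cauchyMoment (X t) 3 0 (z j) (z j)))
      t := by
    refine HasDerivAt.fun_sum fun j _ => ?_
    have hP := hX.invQuot_mul_charDeriv ht₀ h (hz j)
    refine (((hasDerivAt_meanKernel (X t₀) σ t₀ t (charPath σ X t t₀ (z j))
      (hX.invQuot_ne_zero ht₀ h (hz j) (hz j))).const_mul _).const_mul _).congr_deriv ?_
    have hd := hX.charDeriv_ne_zero ht₀ h (hz j)
    rw [hX.moment_three ht₀ h (hz j), eq_inv_of_mul_eq_one_left hP]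
    field_simp
    ring
  have h2 : HasDerivAt (fun τ => ∑ j, ∑ l, s j * charDeriv σ X t t₀ (z j)
      * (s l * charDeriv σ X t t₀ (z l))
      * (2 / (β : ℂ) * covKernel (X t₀) (coeffA t₀ τ) (coeffB σ t₀ τ)
        (charPath σ X t t₀ (z j)) (charPath σ X t t₀ (z l))))
      (∑ j, ∑ l, s j * s l * (2 / (β : ℂ) * 2 * (σ : ℂ) ^ 2
        * cauchyMoment (X t) 2 2 (z j) (z l))) t := by
    refine HasDerivAt.fun_sum fun j _ => HasDerivAt.fun_sum fun l _ => ?_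
    refine (((hasDerivAt_covKernel (X t₀) σ t₀ t (charPath σ X t t₀ (z j))
      (charPath σ X t t₀ (z l))
      (hX.invQuot_ne_zero ht₀ h (hz j) (hz l))).const_mul _).const_mul _).congr_deriv ?_
    rw [hX.moment_two_two ht₀ h (hz j) (hz l) rfl rfl rfl]
    ring
  refine ((h1.const_mul Complex.I).fun_sub (h2.const_mul (1 / 2))).congr_deriv ?_
  rw [sourceCoeff_eq]
  simp only [Finset.mul_sum]
  congr 1
  · exact Finset.sum_congr rfl fun j _ => by ring
  · exact Finset.sum_congr rfl fun j _ => Finset.sum_congr rfl fun l _ => by ring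

lemma explicitSolution_eq (hX : IsLimitProcess σ X) (β : ℝ) {t t₀ : ℝ} (ht₀ : 0 ≤ t₀)
    (h : t₀ ≤ t) {k : ℕ} (φ₀ : (Fin k → ℂ) → (Fin k → ℂ) → ℂ) (s : Fin k → ℂ) {z : Fin k → ℂ}
    (hz : z ∈ OmegaPow k) :
    explicitSolution σ β X t₀ φ₀ t s z
      = φ₀ (fun j => s j * charDeriv σ X t t₀ (z j)) (fun j => charPath σ X t t₀ (z j))
        * Complex.exp (exponent β (X t₀) (coeffA t₀ t) (coeffB σ t₀ t)
          (fun j => s j * charDeriv σ X t t₀ (z j)) (fun j => charPath σ X t t₀ (z j))) := by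
  have e1 : ∀ j, deriv (hTrans σ X t t₀) (z j) = charDeriv σ X t t₀ (z j) := fun j =>
    hX.deriv_hTrans ht₀ h (hz j)
  have e2 : ∀ j, hTrans σ X t t₀ (z j) = charPath σ X t t₀ (z j) := fun j =>
    hX.hTrans_eq ht₀ h (hz j)
  simp only [explicitSolution, exponent, e1, e2, covCoeff, hX.meanCoeff_eq β ht₀ h (hz _),
    hX.genSchwarzian_hTrans ht₀ h (hz _) (hz _)]
  congr 4
  · exact Finset.sum_congr rfl fun j _ => by ring
  · congr 1
    exact funext fun j => Finset.sum_congr rfl fun l _ => by ring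

end IsLimitProcess

/-! ### The equation along characteristics -/

/-- Along a characteristic the transport part of the equation becomes the derivative along a
curve. The derivative is taken at the base point of the characteristic only. -/
lemma IsLimitProcess.hasDerivAt_along_characteristic {σ : ℝ} {X : ℝ → Measure ℝ}
    (hX : IsLimitProcess σ X) {t₀ : ℝ} (ht₀ : 0 ≤ t₀) {k : ℕ}
    {φ : ℝ → (Fin k → ℂ) → (Fin k → ℂ) → ℂ}
    (hcont : ContinuousOn (fun p : ℝ × (Fin k → ℂ) × (Fin k → ℂ) => φ p.1 p.2.1 p.2.2)
      (Ici t₀ ×ˢ (univ ×ˢ OmegaPow k)))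
    (hs : ∀ t : ℝ, t₀ < t → ∀ s : Fin k → ℂ, ∀ z ∈ OmegaPow k, ∀ j : Fin k,
      DifferentiableAt ℂ (fun ζ : ℂ => φ t (Function.update s j ζ) z) (s j))
    (hz : ∀ t : ℝ, t₀ < t → ∀ s : Fin k → ℂ, ∀ z ∈ OmegaPow k, ∀ j : Fin k,
      DifferentiableAt ℂ (fun ζ : ℂ => φ t s (Function.update z j ζ)) (z j))
    {t : ℝ} (ht : t₀ < t) {s z : Fin k → ℂ} (hzO : z ∈ OmegaPow k) {c : ℂ}
    (hc : HasDerivAt (fun τ => φ τ s z) c t) :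
    HasDerivAt (fun τ => φ τ (fun j => s j * charDeriv σ X t τ (z j))
        (fun j => charPath σ X t τ (z j)))
      (c - ∑ j : Fin k,
        (s j * (1 + 2 * (σ : ℂ) ^ 2 * deriv (stieltjes (X t)) (z j))
              * deriv (fun ζ : ℂ => φ t (Function.update s j ζ) z) (s j)
            + (z j + 2 * (σ : ℂ) ^ 2 * stieltjes (X t) (z j))
              * deriv (fun ζ : ℂ => φ t s (Function.update z j ζ)) (z j))) t := by
  have ht0 : 0 ≤ t := ht₀.trans ht.le
  have := hX.isProbabilityMeasure t ht0
  set F : ℝ → (Fin k ⊕ Fin k → ℂ) → ℂ :=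
    fun τ x => φ τ (fun j => x (Sum.inl j)) (fun j => x (Sum.inr j)) with hF
  set x₀ : Fin k ⊕ Fin k → ℂ := Sum.elim s z with hx₀
  set m : ℝ × (Fin k ⊕ Fin k → ℂ) → ℝ × (Fin k → ℂ) × (Fin k → ℂ) :=
    fun q => (q.1, fun j => q.2 (Sum.inl j), fun j => q.2 (Sum.inr j)) with hm
  have hmc : Continuous m := by fun_prop
  have hopen : IsOpen (Ioi t₀ ×ˢ ((univ : Set (Fin k → ℂ)) ×ˢ OmegaPow k)) :=
    isOpen_Ioi.prod (isOpen_univ.prod (isOpen_OmegaPow k))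
  have hmem : ∀ᶠ q in 𝓝 (t, x₀), m q ∈ Ioi t₀ ×ˢ ((univ : Set (Fin k → ℂ)) ×ˢ OmegaPow k) :=
    hmc.continuousAt.eventually_mem (hopen.mem_nhds ⟨ht, mem_univ _, hzO⟩)
  have hul : ∀ (x : Fin k ⊕ Fin k → ℂ) (j : Fin k) (ζ : ℂ),
      (fun i => Function.update x (Sum.inl j) ζ (Sum.inl i))
        = Function.update (fun i => x (Sum.inl i)) j ζ := fun x j ζ =>
    Function.update_comp_eq_of_injective x Sum.inl_injective j ζ
  have hur : ∀ (x : Fin k ⊕ Fin k → ℂ) (j : Fin k) (ζ : ℂ),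
      (fun i => Function.update x (Sum.inr j) ζ (Sum.inr i))
        = Function.update (fun i => x (Sum.inr i)) j ζ := fun x j ζ =>
    Function.update_comp_eq_of_injective x Sum.inr_injective j ζ
  have hv : ∀ j : Fin k ⊕ Fin k, HasDerivAt
      (fun τ => (Sum.elim (fun j => s j * charDeriv σ X t τ (z j))
        (fun j => charPath σ X t τ (z j)) : Fin k ⊕ Fin k → ℂ) j)
      ((Sum.elim (fun j => -(s j * (1 + 2 * (σ : ℂ) ^ 2 * deriv (stieltjes (X t)) (z j))))
        (fun j => -(z j + 2 * (σ : ℂ) ^ 2 * stieltjes (X t) (z j))) :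
        Fin k ⊕ Fin k → ℂ) j) t := by
    rintro (j | j)
    · refine ((hasDerivAt_charDeriv σ X t t (z j)).const_mul (s j)).congr_deriv ?_
      simp only [Sum.elim_inl]
      rw [charDeriv_self, deriv_stieltjes (X t) (hzO j), sub_self, Real.exp_zero,
        Complex.ofReal_one]
      ring
    · refine (hasDerivAt_charPath σ X t t (z j)).congr_deriv ?_
      simp [charPath_self]
  have key := hasDerivAt_along_curve (F := F) (t₀ := t) (x₀ := x₀) (c := c)
    (x := fun τ => Sum.elim (fun j => s j * charDeriv σ X t τ (z j))
      (fun j => charPath σ X t τ (z j)))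
    (v := Sum.elim (fun j => -(s j * (1 + 2 * (σ : ℂ) ^ 2 * deriv (stieltjes (X t)) (z j))))
      (fun j => -(z j + 2 * (σ : ℂ) ^ 2 * stieltjes (X t) (z j))))
    ?_ ?_ hc hv ?_
  · refine key.congr_deriv ?_
    rw [Fintype.sum_sum_type, sub_eq_add_neg, Finset.sum_add_distrib, neg_add,
      ← Finset.sum_neg_distrib, ← Finset.sum_neg_distrib]
    congr 1
    congr 1
    · refine Finset.sum_congr rfl fun j _ => ?_
      simp only [hF, hul, hx₀, Sum.elim_inl, neg_mul]
      simp only [ne_eq, reduceCtorEq, not_false_eq_true, Function.update_of_ne, Sum.elim_inr]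
    · refine Finset.sum_congr rfl fun j _ => ?_
      simp only [hF, hur, hx₀, Sum.elim_inr, neg_mul]
      simp only [ne_eq, reduceCtorEq, not_false_eq_true, Function.update_of_ne, Sum.elim_inl]
  · filter_upwards [hmem] with q hq
    have h1 : ContinuousAt (fun p : ℝ × (Fin k → ℂ) × (Fin k → ℂ) => φ p.1 p.2.1 p.2.2) (m q) :=
      (hcont.mono (prod_mono_left Ioi_subset_Ici_self)).continuousAt (hopen.mem_nhds hq)
    exact ContinuousAt.comp (f := m) h1 hmc.continuousAt
  · filter_upwards [hmem] with q hq
    rintro (j | j)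
    · have := hs q.1 hq.1 (fun j => q.2 (Sum.inl j)) (fun j => q.2 (Sum.inr j)) hq.2.2 j
      simpa only [hF, hul, ne_eq, reduceCtorEq, not_false_eq_true, Function.update_of_ne]
        using this
    · have := hz q.1 hq.1 (fun j => q.2 (Sum.inl j)) (fun j => q.2 (Sum.inr j)) hq.2.2 j
      simpa only [hF, hur, ne_eq, reduceCtorEq, not_false_eq_true, Function.update_of_ne]
        using this
  · simp [hx₀, charDeriv_self, charPath_self]

/-! ### Uniqueness -/

/-- On a characteristic the equation is a scalar linear equation in time, and
`exp (-exponent)` is an integrating factor. -/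
theorem IsSolution.eq_explicitSolution {σ β : ℝ} {X : ℝ → Measure ℝ}
    (hX : IsLimitProcess σ X) {t₀ : ℝ} (ht₀ : 0 ≤ t₀) {k : ℕ}
    {φ₀ : (Fin k → ℂ) → (Fin k → ℂ) → ℂ} {φ : ℝ → (Fin k → ℂ) → (Fin k → ℂ) → ℂ}
    (hφ : IsSolution σ β X t₀ φ₀ φ) {t : ℝ} (ht : t₀ ≤ t) (s : Fin k → ℂ) {z : Fin k → ℂ}
    (hz : z ∈ OmegaPow k) : φ t s z = explicitSolution σ β X t₀ φ₀ t s z := by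
  have ht0 := ht₀.trans ht
  set S : ℝ → Fin k → ℂ := fun τ j => s j * charDeriv σ X t τ (z j) with hS
  set Z : ℝ → Fin k → ℂ := fun τ j => charPath σ X t τ (z j) with hZ
  set E : ℝ → ℂ := fun τ => exponent β (X t₀) (coeffA t₀ τ) (coeffB σ t₀ τ) (S t₀) (Z t₀) with hE
  have hZmem : ∀ τ ≤ t, Z τ ∈ OmegaPow k := fun τ hτ j => hX.charPath_mem ht0 hτ (hz j)
  -- the characteristic through a point of the path is the path itself
  have hZZ : ∀ τ, t₀ ≤ τ → τ ≤ t → ∀ r, (fun j => charPath σ X τ r (Z τ j)) = Z r :=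
    fun τ h1 h2 r => funext fun j => hX.charPath_charPath (ht₀.trans h1) h2 r (hz j)
  have hSS : ∀ τ, t₀ ≤ τ → τ ≤ t → ∀ r,
      (fun j => S τ j * charDeriv σ X τ r (Z τ j)) = S r := fun τ h1 h2 r => funext fun j => by
    have := hX.charDeriv_charPath (ht₀.trans h1) h2 r (hz j)
    simp only [hS, hZ]
    rw [← this]
    ring
  have hEd : ∀ τ, t₀ ≤ τ → τ ≤ t → HasDerivAt E (sourceCoeff σ β (X τ) (S τ) (Z τ)) τ := by
    intro τ h1 h2
    have := hX.hasDerivAt_exponent β ht₀ h1 (S τ) (hZmem τ h2)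
    rwa [hSS τ h1 h2, hZZ τ h1 h2] at this
  have hE0 : E t₀ = 0 := by
    rw [hE]
    simp only [coeffB_self]
    exact exponent_zero_right _ _ _ _ _
  have hφd : ∀ τ ∈ Ioo t₀ t, HasDerivAt (fun r => φ r (S r) (Z r))
      (sourceCoeff σ β (X τ) (S τ) (Z τ) * φ τ (S τ) (Z τ)) τ := by
    intro τ hτ
    have := hX.hasDerivAt_along_characteristic ht₀ hφ.continuousOn hφ.differentiableAt_s
      hφ.differentiableAt_z hτ.1 (hZmem τ hτ.2.le) (hφ.pde τ hτ.1 (S τ) (Z τ) (hZmem τ hτ.2.le))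
    simp only [hSS τ hτ.1.le hτ.2.le, hZZ τ hτ.1.le hτ.2.le, add_sub_cancel_left] at this
    exact this
  have hScont : Continuous S := continuous_pi fun j => continuous_const.mul
    (continuous_iff_continuousAt.2 fun τ => (hasDerivAt_charDeriv σ X t τ (z j)).continuousAt)
  have hZcont : Continuous Z := continuous_pi fun j =>
    continuous_iff_continuousAt.2 fun τ => (hasDerivAt_charPath σ X t τ (z j)).continuousAt
  have hφc : ContinuousOn (fun r => φ r (S r) (Z r)) (Icc t₀ t) :=
    hφ.continuousOn.comp (f := fun r => (r, S r, Z r)) (by fun_prop)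
      fun r hr => ⟨hr.1, mem_univ _, hZmem r hr.2⟩
  have hEc : ContinuousOn E (Icc t₀ t) := fun τ hτ =>
    (hEd τ hτ.1 hτ.2).continuousAt.continuousWithinAt
  have hconst : φ t (S t) (Z t) * Complex.exp (-E t) - φ t₀ (S t₀) (Z t₀) = 0 := by
    refine eq_zero_right_of_linear_ode
      (δ := fun r => φ r (S r) (Z r) * Complex.exp (-E r) - φ t₀ (S t₀) (Z t₀))
      (κ := fun _ => 0) (K := 0) ht ?_ ?_ (fun _ _ => by simp) ?_
    · exact (hφc.mul hEc.neg.cexp).sub continuousOn_const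
    · intro τ hτ
      refine (((hφd τ hτ).fun_mul (hEd τ hτ.1.le hτ.2.le).fun_neg.cexp).sub_const _).congr_deriv ?_
      ring
    · simp [hE0]
  have hSt : S t = s := funext fun j => by simp [hS, charDeriv_self]
  have hZt : Z t = z := funext fun j => by simp [hZ, charPath_self]
  rw [hSt, hZt, sub_eq_zero, hφ.initial _ _ (hZmem t₀ ht)] at hconst
  rw [hX.explicitSolution_eq β ht₀ ht φ₀ s hz]
  have hexp : Complex.exp (-E t) * Complex.exp (E t) = 1 := by
    rw [← Complex.exp_add]
    simp
  calc φ t s z = φ t s z * Complex.exp (-E t) * Complex.exp (E t) := by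
        rw [mul_assoc, hexp, mul_one]
    _ = φ₀ (S t₀) (Z t₀) * Complex.exp (E t) := by rw [hconst]

/-! ### Regularity of the explicit solution -/

section Regularity

variable {V : Type*} [NormedAddCommGroup V] [NormedSpace ℂ V] {ν : Measure ℝ} [IsFiniteMeasure ν]
  {a b y u : V → ℂ} {p : V}

lemma differentiableAt_cauchyMoment_comp (m n : ℕ) (hy : DifferentiableAt ℂ y p)
    (hu : DifferentiableAt ℂ u p) (hyo : y p ∈ Omega) (huo : u p ∈ Omega) :
    DifferentiableAt ℂ (fun e => cauchyMoment ν m n (y e) (u e)) p :=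
  DifferentiableAt.comp (g := fun q : ℂ × ℂ => cauchyMoment ν m n q.1 q.2)
    (f := fun e => (y e, u e)) p (differentiableAt_cauchyMoment ν hyo huo m n) (hy.prodMk hu)

lemma differentiableAt_invQuot (ha : DifferentiableAt ℂ a p) (hb : DifferentiableAt ℂ b p)
    (hy : DifferentiableAt ℂ y p) (hu : DifferentiableAt ℂ u p) (hyo : y p ∈ Omega)
    (huo : u p ∈ Omega) :
    DifferentiableAt ℂ (fun e => invQuot ν (a e) (b e) (y e) (u e)) p :=
  ha.fun_sub (hb.fun_mul (differentiableAt_cauchyMoment_comp 1 1 hy hu hyo huo))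

lemma differentiableAt_meanKernel (ha : DifferentiableAt ℂ a p) (hb : DifferentiableAt ℂ b p)
    (hy : DifferentiableAt ℂ y p) (hyo : y p ∈ Omega)
    (hq : invQuot ν (a p) (b p) (y p) (y p) ≠ 0) :
    DifferentiableAt ℂ (fun e => meanKernel ν (a e) (b e) (y e)) p := by
  simp only [meanKernel, div_eq_mul_inv]
  exact ((hb.const_mul 2).fun_mul (differentiableAt_cauchyMoment_comp 3 0 hy hy hyo hyo)).fun_mul
    ((differentiableAt_invQuot ha hb hy hy hyo hyo).fun_inv hq)

lemma differentiableAt_covKernel (ha : DifferentiableAt ℂ a p) (hb : DifferentiableAt ℂ b p)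
    (hy : DifferentiableAt ℂ y p) (hu : DifferentiableAt ℂ u p) (hyo : y p ∈ Omega)
    (huo : u p ∈ Omega) (hq : invQuot ν (a p) (b p) (y p) (u p) ≠ 0) :
    DifferentiableAt ℂ (fun e => covKernel ν (a e) (b e) (y e) (u e)) p := by
  have hJ := fun m n => differentiableAt_cauchyMoment_comp (ν := ν) m n hy hu hyo huo
  have hQ := differentiableAt_invQuot (ν := ν) ha hb hy hu hyo huo
  simp only [covKernel, div_eq_mul_inv]
  exact ((hb.fun_mul (hJ 2 2)).fun_mul (hQ.fun_inv hq)).fun_add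
    ((((hb.fun_pow 2).fun_mul (hJ 2 1)).fun_mul (hJ 1 2)).fun_mul ((hQ.fun_pow 2).fun_inv
      (pow_ne_zero 2 hq)))

end Regularity

/-- The solution formula as a function of the coefficients `a`, `b` of the inverse flow map, of
`s`, and of the transported points `y_j = h(z_j)`. It is holomorphic in all of them, and time
enters only through `a`, `b` and `y`. -/
def solutionForm (β : ℝ) (ν : Measure ℝ) {k : ℕ} (φ₀ : (Fin k → ℂ) → (Fin k → ℂ) → ℂ)
    (p : ℂ × ℂ × (Fin k → ℂ) × (Fin k → ℂ)) : ℂ :=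
  φ₀ (fun j => p.2.2.1 j * (invQuot ν p.1 p.2.1 (p.2.2.2 j) (p.2.2.2 j))⁻¹) p.2.2.2
    * Complex.exp (exponent β ν p.1 p.2.1
      (fun j => p.2.2.1 j * (invQuot ν p.1 p.2.1 (p.2.2.2 j) (p.2.2.2 j))⁻¹) p.2.2.2)

lemma differentiableAt_solutionForm (β : ℝ) (ν : Measure ℝ) [IsFiniteMeasure ν] {k : ℕ}
    {φ₀ : (Fin k → ℂ) → (Fin k → ℂ) → ℂ}
    (hφ₀ : AnalyticOnNhd ℂ (fun p : (Fin k → ℂ) × (Fin k → ℂ) => φ₀ p.1 p.2)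
      (univ ×ˢ OmegaPow k))
    {a b : ℂ} {s y : Fin k → ℂ} (hy : y ∈ OmegaPow k)
    (hq : ∀ j l, invQuot ν a b (y j) (y l) ≠ 0) :
    DifferentiableAt ℂ (solutionForm β ν φ₀) (a, b, s, y) := by
  set p : ℂ × ℂ × (Fin k → ℂ) × (Fin k → ℂ) := (a, b, s, y)
  have ha : DifferentiableAt ℂ (fun p : ℂ × ℂ × (Fin k → ℂ) × (Fin k → ℂ) => p.1) p := by
    fun_prop
  have hb : DifferentiableAt ℂ (fun p : ℂ × ℂ × (Fin k → ℂ) × (Fin k → ℂ) => p.2.1) p := by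
    fun_prop
  have hyj : ∀ j, DifferentiableAt ℂ
      (fun p : ℂ × ℂ × (Fin k → ℂ) × (Fin k → ℂ) => p.2.2.2 j) p := fun j => by fun_prop
  have hsj : ∀ j, DifferentiableAt ℂ
      (fun p : ℂ × ℂ × (Fin k → ℂ) × (Fin k → ℂ) => p.2.2.1 j) p := fun j => by fun_prop
  have hr : ∀ j, DifferentiableAt ℂ (fun p : ℂ × ℂ × (Fin k → ℂ) × (Fin k → ℂ) =>
      p.2.2.1 j * (invQuot ν p.1 p.2.1 (p.2.2.2 j) (p.2.2.2 j))⁻¹) p := fun j =>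
    (hsj j).fun_mul ((differentiableAt_invQuot ha hb (hyj j) (hyj j) (hy j) (hy j)).fun_inv
      (hq j j))
  have h0 : DifferentiableAt ℂ (fun p : ℂ × ℂ × (Fin k → ℂ) × (Fin k → ℂ) =>
      φ₀ (fun j => p.2.2.1 j * (invQuot ν p.1 p.2.1 (p.2.2.2 j) (p.2.2.2 j))⁻¹) p.2.2.2) p :=
    DifferentiableAt.comp (g := fun p : (Fin k → ℂ) × (Fin k → ℂ) => φ₀ p.1 p.2)
      (f := fun p : ℂ × ℂ × (Fin k → ℂ) × (Fin k → ℂ) =>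
        (fun j => p.2.2.1 j * (invQuot ν p.1 p.2.1 (p.2.2.2 j) (p.2.2.2 j))⁻¹, p.2.2.2)) p
      (hφ₀ _ ⟨mem_univ _, hy⟩).differentiableAt
      ((differentiableAt_pi.2 hr).prodMk (by fun_prop))
  refine h0.fun_mul (DifferentiableAt.cexp ?_)
  refine DifferentiableAt.fun_sub (DifferentiableAt.const_mul (DifferentiableAt.fun_sum
    fun j _ => ?_) _) (DifferentiableAt.const_mul (DifferentiableAt.fun_sum fun j _ =>
      DifferentiableAt.fun_sum fun l _ => ?_) _)
  · exact (hr j).fun_mul ((differentiableAt_meanKernel ha hb (hyj j) (hy j) (hq j j)).const_mul _)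
  · exact ((hr j).fun_mul (hr l)).fun_mul ((differentiableAt_covKernel ha hb (hyj j) (hyj l)
      (hy j) (hy l) (hq j l)).const_mul _)

namespace IsLimitProcess

variable {σ : ℝ} {X : ℝ → Measure ℝ}

lemma explicitSolution_eq_solutionForm (hX : IsLimitProcess σ X) (β : ℝ) {t t₀ : ℝ}
    (ht₀ : 0 ≤ t₀) (h : t₀ ≤ t) {k : ℕ} (φ₀ : (Fin k → ℂ) → (Fin k → ℂ) → ℂ) (s : Fin k → ℂ)
    {z : Fin k → ℂ} (hz : z ∈ OmegaPow k) :
    explicitSolution σ β X t₀ φ₀ t s z = solutionForm β (X t₀) φ₀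
      (coeffA t₀ t, coeffB σ t₀ t, s, fun j => charPath σ X t t₀ (z j)) := by
  have e : ∀ j, (invQuot (X t₀) (coeffA t₀ t) (coeffB σ t₀ t) (charPath σ X t t₀ (z j))
      (charPath σ X t t₀ (z j)))⁻¹ = charDeriv σ X t t₀ (z j) := fun j =>
    (eq_inv_of_mul_eq_one_right (hX.invQuot_mul_charDeriv ht₀ h (hz j))).symm
  rw [hX.explicitSolution_eq β ht₀ h φ₀ s hz, solutionForm]
  simp only [e]

lemma differentiableAt_solutionForm_charPath (hX : IsLimitProcess σ X) (β : ℝ) {t t₀ : ℝ}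
    (ht₀ : 0 ≤ t₀) (h : t₀ ≤ t) {k : ℕ} {φ₀ : (Fin k → ℂ) → (Fin k → ℂ) → ℂ}
    (hφ₀ : AnalyticOnNhd ℂ (fun p : (Fin k → ℂ) × (Fin k → ℂ) => φ₀ p.1 p.2)
      (univ ×ˢ OmegaPow k)) (s : Fin k → ℂ) {z : Fin k → ℂ} (hz : z ∈ OmegaPow k) :
    DifferentiableAt ℂ (solutionForm β (X t₀) φ₀)
      (coeffA t₀ t, coeffB σ t₀ t, s, fun j => charPath σ X t t₀ (z j)) := by
  have := hX.isProbabilityMeasure t₀ ht₀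
  exact differentiableAt_solutionForm β (X t₀) hφ₀
    (fun j => hX.charPath_mem (ht₀.trans h) h (hz j))
    fun j l => hX.invQuot_ne_zero ht₀ h (hz j) (hz l)

lemma continuousOn_explicitSolution (hX : IsLimitProcess σ X) (β : ℝ) {t₀ : ℝ}
    (ht₀ : 0 ≤ t₀) {k : ℕ} {φ₀ : (Fin k → ℂ) → (Fin k → ℂ) → ℂ}
    (hφ₀ : AnalyticOnNhd ℂ (fun p : (Fin k → ℂ) × (Fin k → ℂ) => φ₀ p.1 p.2)
      (univ ×ˢ OmegaPow k)) :
    ContinuousOn (fun p : ℝ × (Fin k → ℂ) × (Fin k → ℂ) =>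
      explicitSolution σ β X t₀ φ₀ p.1 p.2.1 p.2.2) (Ici t₀ ×ˢ (univ ×ˢ OmegaPow k)) := by
  have hA : Continuous (coeffA t₀) :=
    continuous_iff_continuousAt.2 fun t => (hasDerivAt_coeffA t₀ t).continuousAt
  have hB : Continuous (coeffB σ t₀) :=
    continuous_iff_continuousAt.2 fun t => (hasDerivAt_coeffB σ t₀ t).continuousAt
  have hpath : ∀ j, ContinuousOn (fun p : ℝ × (Fin k → ℂ) × (Fin k → ℂ) =>
      charPath σ X p.1 t₀ (p.2.2 j)) (Ici t₀ ×ˢ (univ ×ˢ OmegaPow k)) := by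
    intro j
    have hM : ContinuousOn (fun p : ℝ × (Fin k → ℂ) × (Fin k → ℂ) =>
        stieltjes (X p.1) (p.2.2 j)) (Ici t₀ ×ˢ (univ ×ˢ OmegaPow k)) :=
      hX.continuousOn_stieltjes.comp (f := fun p : ℝ × (Fin k → ℂ) × (Fin k → ℂ) =>
        (p.1, p.2.2 j)) (by fun_prop) fun p hp => ⟨ht₀.trans hp.1, hp.2.2 j⟩
    unfold charPath
    fun_prop
  have hG : ContinuousOn (fun p : ℝ × (Fin k → ℂ) × (Fin k → ℂ) =>
      (coeffA t₀ p.1, coeffB σ t₀ p.1, p.2.1, fun j => charPath σ X p.1 t₀ (p.2.2 j)))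
      (Ici t₀ ×ˢ (univ ×ˢ OmegaPow k)) := by
    have := continuousOn_pi.2 hpath
    fun_prop
  refine ContinuousOn.congr (f := fun p : ℝ × (Fin k → ℂ) × (Fin k → ℂ) =>
    solutionForm β (X t₀) φ₀
      (coeffA t₀ p.1, coeffB σ t₀ p.1, p.2.1, fun j => charPath σ X p.1 t₀ (p.2.2 j))) ?_
    fun p hp => hX.explicitSolution_eq_solutionForm β ht₀ hp.1 φ₀ p.2.1 hp.2.2
  intro p hp
  exact ContinuousAt.comp_continuousWithinAt (g := solutionForm β (X t₀) φ₀)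
    (hX.differentiableAt_solutionForm_charPath β ht₀ hp.1 hφ₀ p.2.1 hp.2.2).continuousAt (hG p hp)

lemma differentiableAt_explicitSolution_time (hX : IsLimitProcess σ X) (β : ℝ) {t t₀ : ℝ}
    (ht₀ : 0 ≤ t₀) (h : t₀ < t) {k : ℕ} {φ₀ : (Fin k → ℂ) → (Fin k → ℂ) → ℂ}
    (hφ₀ : AnalyticOnNhd ℂ (fun p : (Fin k → ℂ) × (Fin k → ℂ) => φ₀ p.1 p.2)
      (univ ×ˢ OmegaPow k)) (s : Fin k → ℂ) {z : Fin k → ℂ} (hz : z ∈ OmegaPow k) :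
    DifferentiableAt ℝ (fun τ => explicitSolution σ β X t₀ φ₀ τ s z) t := by
  have hpath : ∀ j, DifferentiableAt ℝ (fun τ => charPath σ X τ t₀ (z j)) t := by
    intro j
    have h1 := (hasDerivAt_exp_sub_const t₀ t).differentiableAt
    have h2 := (hasDerivAt_exp_const_sub t₀ t).differentiableAt
    have h3 := (hX.hasDerivAt t (ht₀.trans_lt h) (z j) (hz j)).differentiableAt
    exact (h1.mul_const _).fun_add (((h1.fun_sub h2).const_mul _).fun_mul h3)
  have hG : DifferentiableAt ℝ (fun τ => (coeffA t₀ τ, coeffB σ t₀ τ, s,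
      fun j => charPath σ X τ t₀ (z j))) t :=
    (hasDerivAt_coeffA t₀ t).differentiableAt.prodMk
      ((hasDerivAt_coeffB σ t₀ t).differentiableAt.prodMk
        ((differentiableAt_const s).prodMk (differentiableAt_pi.2 hpath)))
  have hΘ := (hX.differentiableAt_solutionForm_charPath β ht₀ h.le hφ₀ s hz).restrictScalars ℝ
  refine (DifferentiableAt.comp (f := fun τ => (coeffA t₀ τ, coeffB σ t₀ τ, s,
      fun j => charPath σ X τ t₀ (z j))) t hΘ hG).congr_of_eventuallyEq ?_
  filter_upwards [Ioi_mem_nhds h] with τ hτ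
  exact hX.explicitSolution_eq_solutionForm β ht₀ (le_of_lt hτ) φ₀ s hz

lemma differentiableAt_explicitSolution_s (hX : IsLimitProcess σ X) (β : ℝ) {t t₀ : ℝ}
    (ht₀ : 0 ≤ t₀) (h : t₀ ≤ t) {k : ℕ} {φ₀ : (Fin k → ℂ) → (Fin k → ℂ) → ℂ}
    (hφ₀ : AnalyticOnNhd ℂ (fun p : (Fin k → ℂ) × (Fin k → ℂ) => φ₀ p.1 p.2)
      (univ ×ˢ OmegaPow k)) (s : Fin k → ℂ) {z : Fin k → ℂ} (hz : z ∈ OmegaPow k) (j : Fin k) :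
    DifferentiableAt ℂ
      (fun ζ : ℂ => explicitSolution σ β X t₀ φ₀ t (Function.update s j ζ) z) (s j) := by
  simp only [fun ζ => hX.explicitSolution_eq_solutionForm β ht₀ h φ₀ (Function.update s j ζ) hz]
  have hΘ := hX.differentiableAt_solutionForm_charPath β ht₀ h hφ₀
    (Function.update s j (s j)) hz
  have hu : DifferentiableAt ℂ (fun ζ => Function.update s j ζ) (s j) :=
    (hasDerivAt_update s j (s j)).differentiableAt
  exact DifferentiableAt.comp (f := fun ζ => (coeffA t₀ t, coeffB σ t₀ t, Function.update s j ζ,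
    fun j => charPath σ X t t₀ (z j))) (s j) hΘ
    ((differentiableAt_const _).prodMk ((differentiableAt_const _).prodMk
      (hu.prodMk (differentiableAt_const _))))

lemma differentiableAt_explicitSolution_z (hX : IsLimitProcess σ X) (β : ℝ) {t t₀ : ℝ}
    (ht₀ : 0 ≤ t₀) (h : t₀ ≤ t) {k : ℕ} {φ₀ : (Fin k → ℂ) → (Fin k → ℂ) → ℂ}
    (hφ₀ : AnalyticOnNhd ℂ (fun p : (Fin k → ℂ) × (Fin k → ℂ) => φ₀ p.1 p.2)
      (univ ×ˢ OmegaPow k)) (s : Fin k → ℂ) {z : Fin k → ℂ} (hz : z ∈ OmegaPow k) (j : Fin k) :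
    DifferentiableAt ℂ
      (fun ζ : ℂ => explicitSolution σ β X t₀ φ₀ t s (Function.update z j ζ)) (z j) := by
  have ht := ht₀.trans h
  have hmem : ∀ ζ ∈ Omega, Function.update z j ζ ∈ OmegaPow k := by
    intro ζ hζ i
    rcases eq_or_ne i j with rfl | hij
    · simpa using hζ
    · simpa [hij] using hz i
  have hΘ := hX.differentiableAt_solutionForm_charPath β ht₀ h hφ₀ s (hmem (z j) (hz j))
  have hu : DifferentiableAt ℂ (fun ζ => Function.update z j ζ) (z j) :=
    (hasDerivAt_update z j (z j)).differentiableAt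
  have hpath : DifferentiableAt ℂ
      (fun ζ => fun i => charPath σ X t t₀ (Function.update z j ζ i)) (z j) := by
    refine differentiableAt_pi.2 fun i => ?_
    exact DifferentiableAt.comp (g := charPath σ X t t₀) (f := fun ζ => Function.update z j ζ i)
      (z j) (hX.hasDerivAt_charPath_space ht t₀ (hmem (z j) (hz j) i)).differentiableAt
      (differentiableAt_pi.1 hu i)
  refine (DifferentiableAt.comp (f := fun ζ => (coeffA t₀ t, coeffB σ t₀ t, s,
    fun i => charPath σ X t t₀ (Function.update z j ζ i))) (z j) hΘ
    ((differentiableAt_const _).prodMk ((differentiableAt_const _).prodMk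
      ((differentiableAt_const _).prodMk hpath)))).congr_of_eventuallyEq ?_
  filter_upwards [isOpen_Omega.mem_nhds (hz j)] with ζ hζ
  exact hX.explicitSolution_eq_solutionForm β ht₀ h φ₀ s (hmem ζ hζ)

/-! ### Existence -/

/-- The explicit function solves the equation. It is known to have a time derivative; its value is
read off from the left derivative along the characteristic through the point, on which only the
exponent varies. -/
theorem isSolution_explicitSolution (hX : IsLimitProcess σ X) (β : ℝ) {t₀ : ℝ}
    (ht₀ : 0 ≤ t₀) {k : ℕ} {φ₀ : (Fin k → ℂ) → (Fin k → ℂ) → ℂ}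
    (hφ₀ : AnalyticOnNhd ℂ (fun p : (Fin k → ℂ) × (Fin k → ℂ) => φ₀ p.1 p.2)
      (univ ×ˢ OmegaPow k)) :
    IsSolution σ β X t₀ φ₀ (explicitSolution σ β X t₀ φ₀) where
  continuousOn := hX.continuousOn_explicitSolution β ht₀ hφ₀
  differentiableAt_s := fun _ ht s _ hz j =>
    hX.differentiableAt_explicitSolution_s β ht₀ ht.le hφ₀ s hz j
  differentiableAt_z := fun _ ht s _ hz j =>
    hX.differentiableAt_explicitSolution_z β ht₀ ht.le hφ₀ s hz j
  pde := by
    intro t ht s z hz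
    have ht0 := ht₀.trans ht.le
    have hD := (hX.differentiableAt_explicitSolution_time β ht₀ ht hφ₀ s hz).hasDerivAt
    have hcurve := hX.hasDerivAt_along_characteristic ht₀
      (hX.continuousOn_explicitSolution β ht₀ hφ₀)
      (fun t ht s z hz j => hX.differentiableAt_explicitSolution_s β ht₀ ht.le hφ₀ s hz j)
      (fun t ht s z hz j => hX.differentiableAt_explicitSolution_z β ht₀ ht.le hφ₀ s hz j)
      ht hz hD
    have hform : HasDerivAt (fun τ =>
        φ₀ (fun j => s j * charDeriv σ X t t₀ (z j)) (fun j => charPath σ X t t₀ (z j))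
          * Complex.exp (exponent β (X t₀) (coeffA t₀ τ) (coeffB σ t₀ τ)
            (fun j => s j * charDeriv σ X t t₀ (z j)) (fun j => charPath σ X t t₀ (z j))))
        (sourceCoeff σ β (X t) s z * explicitSolution σ β X t₀ φ₀ t s z) t := by
      refine ((hX.hasDerivAt_exponent β ht₀ ht.le s hz).cexp.const_mul _).congr_deriv ?_
      rw [hX.explicitSolution_eq β ht₀ ht.le φ₀ s hz]
      ring
    have heq : ∀ τ ∈ Ioc t₀ t, explicitSolution σ β X t₀ φ₀ τ
        (fun j => s j * charDeriv σ X t τ (z j)) (fun j => charPath σ X t τ (z j))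
        = φ₀ (fun j => s j * charDeriv σ X t t₀ (z j)) (fun j => charPath σ X t t₀ (z j))
          * Complex.exp (exponent β (X t₀) (coeffA t₀ τ) (coeffB σ t₀ τ)
            (fun j => s j * charDeriv σ X t t₀ (z j))
            (fun j => charPath σ X t t₀ (z j))) := by
      intro τ hτ
      have e1 : ∀ j, s j * charDeriv σ X t τ (z j)
          * charDeriv σ X τ t₀ (charPath σ X t τ (z j)) = s j * charDeriv σ X t t₀ (z j) :=
        fun j => by
          rw [← hX.charDeriv_charPath (ht₀.trans hτ.1.le) hτ.2 t₀ (hz j)]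
          ring
      have e2 : ∀ j, charPath σ X τ t₀ (charPath σ X t τ (z j)) = charPath σ X t t₀ (z j) :=
        fun j => hX.charPath_charPath (ht₀.trans hτ.1.le) hτ.2 t₀ (hz j)
      rw [hX.explicitSolution_eq β ht₀ hτ.1.le φ₀ _
        fun j => hX.charPath_mem ht0 hτ.2 (hz j)]
      simp only [e1, e2]
    have hval := (uniqueDiffWithinAt_Iic t).eq_deriv _ hcurve.hasDerivWithinAt
      (hform.hasDerivWithinAt.congr_of_eventuallyEq_of_mem
        (by
          filter_upwards [Ioc_mem_nhdsLE ht] with τ hτ using heq τ hτ) (mem_Iic.2 le_rfl))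
    refine hD.congr_deriv ?_
    rw [sub_eq_iff_eq_add.1 hval, add_comm]
    rfl
  initial := by
    intro s z hz
    rw [hX.explicitSolution_eq β ht₀ le_rfl φ₀ s hz, coeffB_self, exponent_zero_right]
    simp [charDeriv_self, charPath_self]

end IsLimitProcess

lemma genSchwarzian_comm (v : ℂ → ℂ) (z w : ℂ) : genSchwarzian v z w = genSchwarzian v w z := by
  rcases eq_or_ne z w with rfl | hne
  · rfl
  · rw [genSchwarzian, genSchwarzian, if_neg hne, if_neg hne.symm, mul_comm (deriv v z),
      sub_sq_comm, sub_sq_comm z]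

end

end DysonFluct

theorem lemma3p2 (σ β : ℝ) (hβ : 0 < β)
    (X : ℝ → MeasureTheory.Measure ℝ) (hX : DysonFluct.IsLimitProcess σ X)
    (k : ℕ) (t₀ : ℝ) (ht₀ : 0 ≤ t₀)
    (φ₀ : (Fin k → ℂ) → (Fin k → ℂ) → ℂ)
    (hφ₀ : AnalyticOnNhd ℂ (fun p : (Fin k → ℂ) × (Fin k → ℂ) => φ₀ p.1 p.2)
      (Set.univ ×ˢ DysonFluct.OmegaPow k)) :
    -- every term of the solution formula is meaningful
    (∀ t : ℝ, t₀ ≤ t →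
      Set.MapsTo (DysonFluct.hTrans σ X t t₀) DysonFluct.Omega DysonFluct.Omega ∧
      DifferentiableOn ℂ (DysonFluct.hTrans σ X t t₀) DysonFluct.Omega ∧
      Set.InjOn (DysonFluct.hTrans σ X t t₀) DysonFluct.Omega ∧
      (∀ z ∈ DysonFluct.Omega, deriv (DysonFluct.hTrans σ X t t₀) z ≠ 0) ∧
      (∀ z₁ ∈ DysonFluct.Omega, ∀ z₂ ∈ DysonFluct.Omega,
        DysonFluct.covCoeff σ β X t t₀ z₁ z₂ = DysonFluct.covCoeff σ β X t t₀ z₂ z₁)) ∧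
    -- the explicit function is a solution
    DysonFluct.IsSolution σ β X t₀ φ₀ (DysonFluct.explicitSolution σ β X t₀ φ₀) ∧
    -- it is the only one
    (∀ φ : ℝ → (Fin k → ℂ) → (Fin k → ℂ) → ℂ, DysonFluct.IsSolution σ β X t₀ φ₀ φ →
      ∀ t : ℝ, t₀ ≤ t → ∀ s : Fin k → ℂ, ∀ z ∈ DysonFluct.OmegaPow k,
        φ t s z = DysonFluct.explicitSolution σ β X t₀ φ₀ t s z) := by
  refine ⟨fun t ht => ⟨?_, ?_, ?_, ?_, ?_⟩, hX.isSolution_explicitSolution β ht₀ hφ₀,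
    fun φ hφ t ht s z hz => hφ.eq_explicitSolution hX ht₀ ht s hz⟩
  · intro z hz
    rw [hX.hTrans_eq ht₀ ht hz]
    exact hX.charPath_mem (ht₀.trans ht) ht hz
  · exact fun z hz => (hX.hasDerivAt_hTrans ht₀ ht hz).differentiableAt.differentiableWithinAt
  · exact (hX.charPath_injOn ht₀ ht).congr fun z hz => (hX.hTrans_eq ht₀ ht hz).symm
  · intro z hz
    rw [hX.deriv_hTrans ht₀ ht hz]
    exact hX.charDeriv_ne_zero ht₀ ht hz
  · intro z₁ _ z₂ _
    rw [DysonFluct.covCoeff, DysonFluct.covCoeff, DysonFluct.genSchwarzian_comm]
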